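/- **Notation.** Let $d\ge 1$. For $\bm n\in\mathbb Z^d$ put $|\bm n|=\max_i|n_i|$, $\langle\bm n\rangle=\max\{1,|\bm n|\}$; for $\bm\omega\in\mathbb R^d$ put $\bm n\cdot\bm\omega=\sum_i n_i\omega_i$; for $a\in\mathbb R$ put $\|a\|_{\mathbb T}=\inf_{k\in\mathbb Z}|a-k|$. For $\gamma>0$, $\tau>d$, let $\mathrm{DC}_{\tau,\gamma}$ be the set of $\bm\omega\in[0,1]^d$ with $\|\bm n\cdot\bm\omega\|_{\mathbb T}\ge\gamma\langle\bm n\rangle^{-\tau}$ for all $\bm n\in\mathbb Z^d\setminus\{0\}$. For $R>0$ let $D_R=\{z\in\mathbb C:|\Im z|<R\}$. $\mathscr P_R$ is the set of $1$-periodic meromorphic functions $g$ on $D_R$ for which there is $c>0$ with $|g(z)-g(z-a)|\ge c\|a\|_{\mathbb T}$ for all $a\in\mathbb R$ and $z\in D_R$ (such that neither $z$ nor $z-a$ is a pole); $|g|_R$ is the largest such $c$. $\mathscr U_{R,s}$ is the set of kernels $\mathcal M=(\mathcal M(z,\bm n))_{z\in D_R,\bm n\in\mathbb Z^d}$ such that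 each $\mathcal M(\cdot,\bm n)$ is a $1$-periodic bounded holomorphic function on $D_R$ and $$\|\mathcal M\|_{R,s}=\sup_{z\in D_R}\sum_{\bm n\in\mathbb Z^d}|\mathcal M(z,\bm n)|\langle\bm n\rangle^s<\infty .$$ $\mathcal M$ is self-adjoint (with respect to $\bm\omega$) if $\mathcal M(z,\bm n)=\overline{\mathcal M(\bar z-\bm n\cdot\bm\omega,-\bm n)}$ for all $z\in D_R$, $\bm n\in\mathbb Z^d$, and $V\in\mathscr P_R$ is self-adjoint if $V(z)=\overline{V(\bar z)}$. For $0\le R'<R$ let $\mathcal Z_{R'}$ be the set of $z\in\mathbb C$ with $|\Im z|\le R'$ such that $z-\bm n\cdot\bm\omega$ is not a pole of $V$ for any $\bm n\in\mathbb Z^d$. For $z\in\mathcal Z_{R'}$ consider on $\ell^2(\mathbb Z^d)$ the operators $$(T_{\mathcal M}(z)\psi)(\bm n)=\sum_{\bm l\in\mathbb Z^d}\mathcal M(z-\bm n\cdot\bm\omega,\bm l-\bm n)\psi(\bm l),\qquad (T_V(z)\psi)(\bm n)=V(z-\bm n\cdot\bm\omega)\psi(\bm n),$$ with their natural domains, and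 $H_z=T_{\mathcal M}(z)+T_V(z)$. **Theorem 1.2.** Let $d\ge1$, $R,\alpha_0,\gamma,\delta>0$, $\tau>d$, $v>0$ and $$s>\alpha_0+\tau+\frac d2+7\delta .$$ There is $\varepsilon_0>0$, depending only on $R,\alpha_0,\gamma,\tau,v,\delta,s,d$, such that the following holds for all $\bm\omega\in\mathrm{DC}_{\tau,\gamma}$, all $V\in\mathscr P_R$ with $|V|_R=v$ and all $\mathcal M\in\mathscr U_{R,s}$ with $\|\mathcal M\|_{R,s}<\varepsilon_0$. 1. For every $z\in\mathcal Z_{R/2}$ the operator $H_z$ has a complete set of normalized eigenfunctions $\{\varphi_{\bm n}\}_{\bm n\in\mathbb Z^d}$ (each $\varphi_{\bm n}$ lies in the domain of $H_z$, is an eigenvector of $H_z$, $\|\varphi_{\bm n}\|_{\ell^2}=1$, and the closed linear span of the $\varphi_{\bm n}$ is $\ell^2(\mathbb Z^d)$) with $$|\varphi_{\bm n}(\bm i)|\le 2\langle\bm n-\bm i\rangle^{-s+\tau+7\delta}\qquad\text{for all }\bm n,\bm i\in\mathbb Z^d .$$ 2. If in addition $\mathcal M$ and $V$ are self-adjoint,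 then for every $x\in\mathcal Z_0$ the operator $H_x$ is self-adjoint and its spectrum equals $\mathbb R$. -/

import Mathlib

open scoped ENNReal lp

noncomputable section

namespace PowerLaw

/-- The lattice `ℤ^d`; as a `Pi` type it carries the maximum norm `|n| = max_i |n_i|`. -/
abbrev Lattice (d : ℕ) : Type := Fin d → ℤ

/-- The Hilbert space `ℓ²(ℤ^d)`. -/
abbrev Hilb (d : ℕ) : Type := ℓ²(Lattice d, ℂ)

/-- The bracket `⟨n⟩ = max {1, |n|}`. -/
def bracket {d : ℕ} (n : Lattice d) : ℝ := max 1 ‖n‖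

/-- `n · ω = ∑ n_i ω_i`. -/
def dotFreq {d : ℕ} (n : Lattice d) (ω : Fin d → ℝ) : ℝ := ∑ i, (n i : ℝ) * ω i

/-- `‖a‖_𝕋`, the distance from the real number `a` to the nearest integer. -/
def torusNorm (a : ℝ) : ℝ := ‖(a : UnitAddCircle)‖

/-- The `(τ, γ)`-Diophantine frequencies in `[0,1]^d`. -/
def DC (d : ℕ) (τ γ : ℝ) : Set (Fin d → ℝ) :=
  {ω | (∀ i, ω i ∈ Set.Icc (0 : ℝ) 1) ∧
    ∀ n : Lattice d, n ≠ 0 → γ / bracket n ^ τ ≤ torusNorm (dotFreq n ω)}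

/-- The open strip `D_R = {z : |Im z| < R}`. -/
def strip (R : ℝ) : Set ℂ := {z | |z.im| < R}

/-- `f` has a pole at `z`. -/
def IsPole (f : ℂ → ℂ) (z : ℂ) : Prop := meromorphicOrderAt f z < 0

/-- `c` is an admissible constant in `|g(z) - g(z-a)| ≥ c ‖a‖_𝕋` for `a ∈ ℝ`, `z ∈ D_R`; the
inequality is required where both values are finite. -/
def MonotoneConst (R : ℝ) (g : ℂ → ℂ) (c : ℝ) : Prop :=
  ∀ z ∈ strip R, ∀ a : ℝ, ¬ IsPole g z → ¬ IsPole g (z - a) →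
    c * torusNorm a ≤ ‖g z - g (z - a)‖

/-- The class `𝒫_R` of 1-periodic meromorphic functions on `D_R` that satisfy the monotonicity
condition with some constant `c > 0`.  A meromorphic function is represented by its normal form:
it is analytic off its poles, and has the conventional value `0` at a pole. -/
structure PotentialClass (R : ℝ) (g : ℂ → ℂ) : Prop where
  meromorphic : MeromorphicNFOn g (strip R)
  periodic : ∀ z ∈ strip R, g (z + 1) = g z
  monotone : ∃ c : ℝ, 0 < c ∧ MonotoneConst R g c

/-- `|g|_R`, the biggest admissible constant in the monotonicity condition. -/
def monotoneModulus (R : ℝ) (g : ℂ → ℂ) : ℝ := sSup {c : ℝ | MonotoneConst R g c}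

/-- `ℋ_R`: bounded holomorphic functions on `D_R` of period 1. -/
structure HoloClass (R : ℝ) (f : ℂ → ℂ) : Prop where
  holomorphic : DifferentiableOn ℂ f (strip R)
  periodic : ∀ z ∈ strip R, f (z + 1) = f z
  bounded : ∃ C : ℝ, ∀ z ∈ strip R, ‖f z‖ ≤ C

/-- `sup_{z ∈ D_R} ∑_n |ℳ(z,n)| ⟨n⟩^s`, as an element of `[0,∞]`. -/
def kernelENorm {d : ℕ} (R s : ℝ) (M : ℂ → Lattice d → ℂ) : ℝ≥0∞ :=
  ⨆ z ∈ strip R, ∑' n, ENNReal.ofReal (‖M z n‖ * bracket n ^ s)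

/-- The space `𝒰_{R,s}` of holomorphic kernels. -/
structure KernelSpace {d : ℕ} (R s : ℝ) (M : ℂ → Lattice d → ℂ) : Prop where
  holo : ∀ n, HoloClass R fun z => M z n
  finite : kernelENorm R s M < ∞

/-- The norm `‖ℳ‖_{R,s}`, for `ℳ ∈ 𝒰_{R,s}`. -/
def kernelNorm {d : ℕ} (R s : ℝ) (M : ℂ → Lattice d → ℂ) : ℝ := (kernelENorm R s M).toReal

/-- The involution `ℳ*(z,n) = conj (ℳ(conj z - n·ω, -n))`. -/
def kernelStar {d : ℕ} (ω : Fin d → ℝ) (M : ℂ → Lattice d → ℂ) : ℂ → Lattice d → ℂ :=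
  fun z n => star (M (star z - dotFreq n ω) (-n))

/-- `ℳ* = ℳ` as kernels on `D_R`. -/
def KernelSelfAdjoint {d : ℕ} (R : ℝ) (ω : Fin d → ℝ) (M : ℂ → Lattice d → ℂ) : Prop :=
  ∀ z ∈ strip R, ∀ n, kernelStar ω M z n = M z n

/-- `V* = V` on `D_R`, with `V*(z) = conj (V(conj z))`. -/
def PotentialSelfAdjoint (R : ℝ) (V : ℂ → ℂ) : Prop :=
  ∀ z ∈ strip R, star (V (star z)) = V z

/-- The set `𝒵_{R'}` of phases `z` with `|Im z| ≤ R'` such that no `z - n·ω` is a pole of `V`. -/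
def phaseSet {d : ℕ} (ω : Fin d → ℝ) (V : ℂ → ℂ) (R' : ℝ) : Set ℂ :=
  {z | |z.im| ≤ R' ∧ ∀ n : Lattice d, ¬ IsPole V (z - dotFreq n ω)}

/-- The operator `(T_ℳ(z) ψ)(n) = ∑_l ℳ(z - n·ω, l - n) ψ(l)` on its natural domain: all
`ψ ∈ ℓ²` for which every series converges and the result is in `ℓ²`. -/
def hoppingOp {d : ℕ} (ω : Fin d → ℝ) (M : ℂ → Lattice d → ℂ) (z : ℂ) :
    Hilb d →ₗ.[ℂ] Hilb d where
  domain :=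
    { carrier := {ψ | (∀ n, Summable fun l => M (z - dotFreq n ω) (l - n) * ψ l) ∧
        Memℓp (fun n => ∑' l, M (z - dotFreq n ω) (l - n) * ψ l) 2}
      add_mem' := by
        rintro ψ χ ⟨hψ, hψ'⟩ ⟨hχ, hχ'⟩
        have h : ∀ n, (fun l => M (z - dotFreq n ω) (l - n) * (ψ + χ) l) =
            fun l => M (z - dotFreq n ω) (l - n) * ψ l + M (z - dotFreq n ω) (l - n) * χ l :=
          fun n => funext fun l => by rw [lp.coeFn_add, Pi.add_apply, mul_add]
        refine ⟨fun n => (h n) ▸ (hψ n).add (hχ n), ?_⟩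
        convert hψ'.add hχ' using 1
        funext n
        rw [h n, (hψ n).tsum_add (hχ n)]
        rfl
      zero_mem' := by
        have h : ∀ n, (fun l => M (z - dotFreq n ω) (l - n) * (0 : Hilb d) l) = fun _ => 0 :=
          fun n => funext fun l => by rw [lp.coeFn_zero, Pi.zero_apply, mul_zero]
        refine ⟨fun n => (h n) ▸ summable_zero, ?_⟩
        simp only [h, tsum_zero]
        exact zero_memℓp
      smul_mem' := by
        rintro c ψ ⟨hψ, hψ'⟩
        have h : ∀ n, (fun l => M (z - dotFreq n ω) (l - n) * (c • ψ) l) =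
            fun l => c * (M (z - dotFreq n ω) (l - n) * ψ l) :=
          fun n => funext fun l => by
            rw [lp.coeFn_smul, Pi.smul_apply, smul_eq_mul]; ring
        refine ⟨fun n => (h n) ▸ (hψ n).mul_left c, ?_⟩
        convert hψ'.const_smul c using 1
        funext n
        rw [h n, tsum_mul_left]
        rfl }
  toFun :=
    { toFun := fun ψ => ⟨fun n => ∑' l, M (z - dotFreq n ω) (l - n) * (ψ : Hilb d) l, ψ.2.2⟩
      map_add' := by
        intro ψ χ
        ext n
        change ∑' l, M (z - dotFreq n ω) (l - n) * ((ψ : Hilb d) l + (χ : Hilb d) l) =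
          ∑' l, M (z - dotFreq n ω) (l - n) * (ψ : Hilb d) l +
            ∑' l, M (z - dotFreq n ω) (l - n) * (χ : Hilb d) l
        rw [← (ψ.2.1 n).tsum_add (χ.2.1 n)]
        simp only [mul_add]
      map_smul' := by
        intro c ψ
        ext n
        change ∑' l, M (z - dotFreq n ω) (l - n) * (c * (ψ : Hilb d) l) =
          c * ∑' l, M (z - dotFreq n ω) (l - n) * (ψ : Hilb d) l
        rw [← tsum_mul_left]
        exact tsum_congr fun l => by ring }

/-- The multiplication operator `(T_V(z) ψ)(n) = V(z - n·ω) ψ(n)` on its maximal domain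
`{ψ ∈ ℓ² : T_V(z) ψ ∈ ℓ²}`; it is meaningful when no `z - n·ω` is a pole of `V`. -/
def potentialOp {d : ℕ} (ω : Fin d → ℝ) (V : ℂ → ℂ) (z : ℂ) : Hilb d →ₗ.[ℂ] Hilb d where
  domain :=
    { carrier := {ψ | Memℓp (fun n => V (z - dotFreq n ω) * ψ n) 2}
      add_mem' := by
        intro ψ χ hψ hχ
        change Memℓp (fun n => V (z - dotFreq n ω) * (ψ n + χ n)) 2
        simp only [mul_add]
        exact Memℓp.add hψ hχ
      zero_mem' := by
        change Memℓp (fun n => V (z - dotFreq n ω) * (0 : ℂ)) 2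
        simp only [mul_zero]
        exact zero_memℓp
      smul_mem' := by
        intro c ψ hψ
        change Memℓp (fun n => V (z - dotFreq n ω) * (c * ψ n)) 2
        simp only [mul_left_comm _ c]
        exact Memℓp.const_smul hψ c }
  toFun :=
    { toFun := fun ψ => ⟨fun n => V (z - dotFreq n ω) * (ψ : Hilb d) n, ψ.2⟩
      map_add' := by
        intro ψ χ
        ext n
        exact mul_add _ _ _
      map_smul' := by
        intro c ψ
        ext n
        exact mul_left_comm _ _ _ }

/-- `H_z = T_ℳ(z) + T_V(z)`, a (generally unbounded) operator on `ℓ²(ℤ^d)` whose domain is the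
intersection of the domains of the two summands. -/
def hamiltonian {d : ℕ} (ω : Fin d → ℝ) (M : ℂ → Lattice d → ℂ) (V : ℂ → ℂ) (z : ℂ) :
    Hilb d →ₗ.[ℂ] Hilb d :=
  hoppingOp ω M z + potentialOp ω V z

section Operators

variable {E : Type*} [NormedAddCommGroup E] [NormedSpace ℂ E]

/-- `φ` is an eigenvector of the unbounded operator `A`. -/
def IsEigenvector (A : E →ₗ.[ℂ] E) (φ : E) : Prop :=
  φ ≠ 0 ∧ ∃ (μ : ℂ) (h : φ ∈ A.domain), A ⟨φ, h⟩ = μ • φ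

/-- The resolvent set of an unbounded operator `A`: those `μ` for which `A - μ`, as a map from
the domain of `A` to the whole space, has a bounded two-sided inverse. -/
def unboundedResolventSet (A : E →ₗ.[ℂ] E) : Set ℂ :=
  {μ | ∃ S : E →L[ℂ] E,
    (∀ y, ∃ h : S y ∈ A.domain, A ⟨S y, h⟩ - μ • S y = y) ∧
    ∀ x : A.domain, S (A x - μ • (x : E)) = x}

/-- The spectrum of an unbounded operator. -/
def unboundedSpectrum (A : E →ₗ.[ℂ] E) : Set ℂ := (unboundedResolventSet A)ᶜ

end Operators

end PowerLaw

end

noncomputable section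

namespace PowerLaw

open Filter Topology MeasureTheory

/-! ### Distance to the nearest integer -/

section Torus

/-! Kernels multiply by `kmul` as their operators compose. It therefore suffices to find a kernel U
close to the identity and a function η with (V + M)U = U(V + η). Column n of the operator A attached
to U is then an eigenvector with eigenvalue (V + η)(z - n·ω). It is localized near n because U
decays off the diagonal, and the columns are complete because A has a right inverse.

Correcting an approximate solution with error E requires division by (V + η)(z) - (V + η)(z - n·ω).
By monotonicity of V and the Diophantine condition, this divisor is at least of order vγ⟨n⟩^{-τ} as
long as η varies by at most (v/2)‖a‖ under a real shift a. The same lower bound makes its reciprocal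
holomorphic across the poles of V.

Since M decays only polynomially, the loss ⟨n⟩^τ cannot be iterated in one fixed norm. Step j
therefore uses the truncation of M to ⟨n⟩ < 2^j and the exponential weight of rate 2^{-j}. The shell
of M added at step j has size 2^{-sj}, and halving the weight pays for the divisors at the price
2^{τj}. So U changes by order 2^{(τ-s)j}, and a Cauchy estimate on strips with gaps of order 2^{-j}
bounds the variation added to η by order 2^{(1-s)j}; both are summable for s > τ ≥ 1. Quadratic
convergence is not needed: U is never inverted, the new error contains (U - 1)E, and a small
multiple of E is enough because E only has to shrink by 2^{-s} per step. The induction is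
`ApproxDiag.Good.next`. Summing over scales, `kerMajorant_le` yields decay ⟨n⟩^{-t} for every t < s
- τ.

In the self-adjoint case H is a real diagonal operator plus a bounded symmetric one, hence
self-adjoint. If a real E were outside the spectrum, the eigenvalues would keep a distance from E,
and by density of the orbit so would V + η on the whole real axis. Then 1/(V + η - E) extends to a
continuous real periodic function, which must take equal values at two points y and y + a. This
contradicts the monotonicity of V + η (`PotentialClass.not_bounded_away`). -/

lemma torusNorm_nonneg (a : ℝ) : 0 ≤ torusNorm a := norm_nonneg _

lemma exists_int_torusNorm_eq (a : ℝ) : ∃ k : ℤ, torusNorm a = |a - k| :=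
  ⟨round a, UnitAddCircle.norm_eq⟩

lemma torusNorm_le_abs_sub (a : ℝ) (k : ℤ) : torusNorm a ≤ |a - k| := by
  rw [torusNorm, UnitAddCircle.norm_eq]
  exact round_le a k

lemma torusNorm_intCast (k : ℤ) : torusNorm k = 0 :=
  le_antisymm (by simpa using torusNorm_le_abs_sub k k) (torusNorm_nonneg _)

lemma torusNorm_pos_of_mem_Ioo {a : ℝ} (h : a ∈ Set.Ioo (0 : ℝ) 1) : 0 < torusNorm a := by
  obtain ⟨k, hk⟩ := exists_int_torusNorm_eq a
  rw [hk, abs_pos, sub_ne_zero]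
  rintro rfl
  have h0 : (0 : ℤ) < k := by exact_mod_cast h.1
  have h1 : k < (1 : ℤ) := by exact_mod_cast h.2
  omega

end Torus

/-! ### Brackets and shifts of the phase -/

section Bracket

variable {d : ℕ}

lemma one_le_bracket (n : Lattice d) : 1 ≤ bracket n := le_max_left _ _

lemma bracket_pos (n : Lattice d) : 0 < bracket n := one_pos.trans_le (one_le_bracket n)

lemma bracket_zero : bracket (0 : Lattice d) = 1 := by simp [bracket]

lemma norm_le_bracket (n : Lattice d) : ‖n‖ ≤ bracket n := le_max_right _ _

lemma bracket_le (n : Lattice d) : bracket n ≤ 1 + ‖n‖ :=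
  max_le (by linarith [norm_nonneg n]) (by linarith)

lemma rpow_le_mul_exp {u t : ℝ} (hu : 0 ≤ u) (ht : 0 < t) : u ^ t ≤ t ^ t * Real.exp u := by
  have h1 : u / t ≤ Real.exp (u / t) := by linarith [Real.add_one_le_exp (u / t)]
  have h2 : (u / t) ^ t ≤ Real.exp u := by
    calc (u / t) ^ t ≤ Real.exp (u / t) ^ t := by gcongr
      _ = Real.exp u := by rw [← Real.exp_mul, div_mul_cancel₀ _ ht.ne']
  rw [Real.div_rpow hu ht.le, div_le_iff₀ (by positivity)] at h2
  linarith

/-- The exchange rate between powers and exponentials, used in both directions at ρ = 2^{-(j+1)}: it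
absorbs small divisors into the weight, and it turns exponential decay at scale j into power-law
decay. -/
lemma bracket_rpow_le {t ρ : ℝ} (ht : 0 < t) (hρ : 0 < ρ) (hρ1 : ρ ≤ 1) (n : Lattice d) :
    bracket n ^ t ≤ t ^ t * Real.exp 1 * (ρ ^ t)⁻¹ * Real.exp (ρ * ‖n‖) := by
  have hb := bracket_pos n
  have h1 := rpow_le_mul_exp (u := ρ * bracket n) (by positivity) ht
  rw [Real.mul_rpow hρ.le hb.le] at h1
  have h2 : Real.exp (ρ * bracket n) ≤ Real.exp 1 * Real.exp (ρ * ‖n‖) := by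
    rw [← Real.exp_add]
    gcongr
    nlinarith [bracket_le n, norm_nonneg n]
  have hp : 0 < ρ ^ t := by positivity
  calc bracket n ^ t = (ρ ^ t)⁻¹ * (ρ ^ t * bracket n ^ t) := by field_simp
    _ ≤ (ρ ^ t)⁻¹ * (t ^ t * (Real.exp 1 * Real.exp (ρ * ‖n‖))) := by
        refine mul_le_mul_of_nonneg_left (h1.trans ?_) (by positivity)
        exact mul_le_mul_of_nonneg_left h2 (by positivity)
    _ = _ := by ring

lemma dotFreq_add (m n : Lattice d) (ω : Fin d → ℝ) :
    dotFreq (m + n) ω = dotFreq m ω + dotFreq n ω := by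
  simp [dotFreq, add_mul, Finset.sum_add_distrib]

lemma dotFreq_neg (n : Lattice d) (ω : Fin d → ℝ) : dotFreq (-n) ω = -dotFreq n ω := by
  simp [dotFreq]

lemma dotFreq_sub (m n : Lattice d) (ω : Fin d → ℝ) :
    dotFreq (m - n) ω = dotFreq m ω - dotFreq n ω := by
  rw [sub_eq_add_neg, dotFreq_add, dotFreq_neg, sub_eq_add_neg]

@[simp] lemma dotFreq_zero (ω : Fin d → ℝ) : dotFreq (0 : Lattice d) ω = 0 := by simp [dotFreq]

lemma sub_dotFreq_sub (z : ℂ) (m n : Lattice d) (ω : Fin d → ℝ) :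
    z - dotFreq m ω - dotFreq (n - m) ω = z - dotFreq n ω := by
  rw [dotFreq_sub]; push_cast; ring

lemma sub_dotFreq_add (z : ℂ) (m n : Lattice d) (ω : Fin d → ℝ) :
    z - dotFreq m ω - dotFreq n ω = z - dotFreq (m + n) ω := by
  rw [dotFreq_add]; push_cast; ring

end Bracket

/-! ### Periodic holomorphic functions on strips -/

section Strip

lemma isOpen_strip (R : ℝ) : IsOpen (strip R) :=
  isOpen_lt (Complex.continuous_im.abs) continuous_const

lemma strip_mono {r r' : ℝ} (h : r ≤ r') : strip r ⊆ strip r' := fun _ hz => lt_of_lt_of_le hz h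

lemma sub_real_mem_strip {r : ℝ} {z : ℂ} (hz : z ∈ strip r) (a : ℝ) : z - a ∈ strip r := by
  simpa [strip] using hz

lemma add_one_mem_strip {r : ℝ} {z : ℂ} (hz : z ∈ strip r) : z + 1 ∈ strip r := by
  simpa [strip] using hz

lemma convex_strip (r : ℝ) : Convex ℝ (strip r) := by
  have : strip r = Complex.imLm ⁻¹' Set.Ioo (-r) r := by
    ext z; simp [strip, abs_lt]
  rw [this]
  exact (convex_Ioo _ _).linear_preimage _

/-- Holomorphic functions of period one on a strip. -/
structure HoloPer (r : ℝ) (f : ℂ → ℂ) : Prop where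
  diff : DifferentiableOn ℂ f (strip r)
  per : ∀ z ∈ strip r, f (z + 1) = f z

lemma HoloPer.mono {r r' : ℝ} {f : ℂ → ℂ} (h : HoloPer r f) (hr : r' ≤ r) : HoloPer r' f :=
  ⟨h.diff.mono (strip_mono hr), fun z hz => h.per z (strip_mono hr hz)⟩

lemma periodic_int {r : ℝ} {f : ℂ → ℂ} (h : ∀ z ∈ strip r, f (z + 1) = f z) {z : ℂ}
    (hz : z ∈ strip r) (k : ℤ) : f (z - k) = f z := by
  have key : ∀ k : ℕ, ∀ z ∈ strip r, f (z + k) = f z := by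
    intro k
    induction k with
    | zero => simp
    | succ k ih =>
      intro z hz
      have h1 : z + k ∈ strip r := by simpa [strip] using hz
      rw [Nat.cast_succ, ← add_assoc, h _ h1, ih z hz]
  obtain ⟨m, rfl | rfl⟩ := k.eq_nat_or_neg
  · have h1 : z - (m : ℤ) ∈ strip r := by simpa [strip] using hz
    have := key m _ h1
    simpa using this.symm
  · simpa using key m z hz

/-- Cauchy's estimate bounds the derivative by B over the gap between the strips. Periodicity allows
a to be replaced by its distance to the nearest integer before the mean value inequality is applied.
-/
lemma HoloPer.norm_sub_le {r r' B : ℝ} {f : ℂ → ℂ} (h : HoloPer r f) (hr : r' < r)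
    (hB : ∀ z ∈ strip r, ‖f z‖ ≤ B) {z : ℂ} (hz : z ∈ strip r') (a : ℝ) :
    ‖f z - f (z - a)‖ ≤ B / (r - r') * torusNorm a := by
  have hd : ∀ w ∈ strip r', ‖deriv f w‖ ≤ B / (r - r') := by
    intro w hw
    have hB0 : 0 ≤ B := (norm_nonneg _).trans (hB w (strip_mono hr.le hw))
    have him : |w.im| < r' := hw
    have hlim : ∀ ρ ∈ Set.Ioo 0 (r - r'), ‖deriv f w‖ ≤ B / ρ := by
      intro ρ hρ
      have hsub : Metric.closedBall w ρ ⊆ strip r := by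
        intro u hu
        have h1 : |(u - w).im| ≤ ρ := (Complex.abs_im_le_norm _).trans (by simpa [dist_eq_norm] using hu)
        have h2 : |u.im| ≤ |(u - w).im| + |w.im| := by
          have := abs_add_le (u - w).im w.im
          simpa using this
        have := hρ.2
        show |u.im| < r
        linarith
      refine Complex.norm_deriv_le_of_forall_mem_sphere_norm_le hρ.1 ?_ fun u hu =>
        hB u (hsub (Metric.sphere_subset_closedBall hu))
      refine DifferentiableOn.diffContOnCl ?_
      rw [closure_ball w hρ.1.ne']
      exact h.diff.mono hsub
    have hpos : 0 < r - r' := by linarith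
    have ht : Tendsto (fun ρ : ℝ => B / ρ) (𝓝[<] (r - r')) (𝓝 (B / (r - r'))) :=
      ((continuousAt_const.div continuousAt_id hpos.ne').tendsto).mono_left nhdsWithin_le_nhds
    exact ge_of_tendsto ht (by
      filter_upwards [Ioo_mem_nhdsLT hpos] with ρ hρ using hlim ρ hρ)
  obtain ⟨k, hk⟩ := exists_int_torusNorm_eq a
  have hz' : z - ((a - k : ℝ) : ℂ) ∈ strip r' := sub_real_mem_strip hz _
  have e : f (z - a) = f (z - ((a - k : ℝ) : ℂ)) := by
    rw [← periodic_int h.per (strip_mono hr.le hz') k]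
    congr 1; push_cast; ring
  rw [e, hk]
  have := (convex_strip r').norm_image_sub_le_of_norm_deriv_le (f := f)
    (fun w hw => h.diff.differentiableAt ((isOpen_strip r).mem_nhds (strip_mono hr.le hw))) hd hz' hz
  refine this.trans_eq ?_
  congr 1
  rw [sub_sub_cancel, Complex.norm_real, Real.norm_eq_abs]

end Strip

/-- The real supremum is 0 for an empty or unbounded set, so v > 0 excludes both cases. The supremum
is then itself admissible, the condition being closed in the constant. -/
lemma monotoneConst_of_monotoneModulus {R v : ℝ} {V : ℂ → ℂ} (hv : 0 < v)
    (h : monotoneModulus R V = v) : MonotoneConst R V v := by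
  have hbdd : BddAbove {c : ℝ | MonotoneConst R V c} := by
    by_contra hb
    rw [monotoneModulus, Real.sSup_of_not_bddAbove hb] at h
    exact hv.ne h
  have hne : {c : ℝ | MonotoneConst R V c}.Nonempty := by
    by_contra hb
    rw [monotoneModulus, Set.not_nonempty_iff_eq_empty.mp hb, Real.sSup_empty] at h
    exact hv.ne h
  intro z hz a h1 h2
  rcases (torusNorm_nonneg a).eq_or_lt with h0 | h0
  · simp [← h0]
  · rw [← le_div_iff₀ h0, ← h, monotoneModulus]
    exact csSup_le hne fun c hc => (le_div_iff₀ h0).mpr (hc z hz a h1 h2)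

/-! ### Holomorphic reciprocals of the small divisors -/

section Inverse

/-- A meromorphic function on an open set that is bounded below off a discrete set has a
holomorphic reciprocal. -/
lemma exists_holomorphic_inv {U : Set ℂ} {h : ℂ → ℂ} {c : ℝ} (hc : 0 < c)
    (hm : MeromorphicOn h U) (hb : ∀ z ∈ U, ∀ᶠ w in 𝓝[≠] z, c ≤ ‖h w‖) :
    ∃ g : ℂ → ℂ, DifferentiableOn ℂ g U ∧ (∀ z ∈ U, ‖g z‖ ≤ c⁻¹) ∧
      (∀ z ∈ U, ∀ᶠ w in 𝓝[≠] z, g w = (h w)⁻¹) ∧ ∀ z ∈ U, ContinuousAt h z → g z * h z = 1 := by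
  have hmi : MeromorphicOn h⁻¹ U := hm.inv
  have heq : ∀ z ∈ U, ∀ᶠ w in 𝓝[≠] z, toMeromorphicNFOn h⁻¹ U w = (h w)⁻¹ := fun z hz => by
    filter_upwards [hmi.toMeromorphicNFOn_eq_self_on_nhdsNE hz] with w hw
    rw [hw, Pi.inv_apply]
  have hbd : ∀ z ∈ U, ∀ᶠ w in 𝓝[≠] z, ‖toMeromorphicNFOn h⁻¹ U w‖ ≤ c⁻¹ := fun z hz => by
    filter_upwards [heq z hz, hb z hz] with w hw hw'
    rw [hw, norm_inv]
    exact inv_anti₀ hc hw'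
  -- A pole of the normal form would force its modulus to infinity in a punctured neighbourhood,
  -- against the bound by `c⁻¹`.
  have han : ∀ z ∈ U, AnalyticAt ℂ (toMeromorphicNFOn h⁻¹ U) z := by
    intro z hz
    have hnf : MeromorphicNFAt (toMeromorphicNFOn h⁻¹ U) z :=
      meromorphicNFOn_toMeromorphicNFOn _ _ hz
    rw [← hnf.meromorphicOrderAt_nonneg_iff_analyticAt]
    by_contra hneg
    push Not at hneg
    have ht := (tendsto_cobounded_iff_meromorphicOrderAt_neg hnf.meromorphicAt).mpr hneg
    have h1 := (tendsto_norm_atTop_iff_cobounded.mpr ht).eventually_gt_atTop c⁻¹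
    obtain ⟨w, hw1, hw2⟩ := (h1.and (hbd z hz)).exists
    exact absurd hw2 (not_le.mpr hw1)
  refine ⟨toMeromorphicNFOn h⁻¹ U, fun z hz => (han z hz).differentiableAt.differentiableWithinAt,
    fun z hz => ?_, heq, fun z hz hcz => ?_⟩
  · exact le_of_tendsto ((han z hz).continuousAt.norm.tendsto.mono_left nhdsWithin_le_nhds)
      (hbd z hz)
  · have h1 : Tendsto (fun w => toMeromorphicNFOn h⁻¹ U w * h w) (𝓝[≠] z)
        (𝓝 (toMeromorphicNFOn h⁻¹ U z * h z)) :=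
      (((han z hz).continuousAt.mul hcz).tendsto).mono_left nhdsWithin_le_nhds
    refine tendsto_nhds_unique h1 (tendsto_const_nhds.congr' ?_)
    filter_upwards [heq z hz, hb z hz] with w hw hw'
    have : h w ≠ 0 := norm_pos_iff.mp (hc.trans_le hw')
    rw [hw, inv_mul_cancel₀ this]

end Inverse

section Potential

variable {R v : ℝ} {V : ℂ → ℂ}

lemma PotentialClass.analyticAt (hV : PotentialClass R V) {z : ℂ} (hz : z ∈ strip R)
    (h : ¬ IsPole V z) : AnalyticAt ℂ V z :=
  ((hV.meromorphic hz).meromorphicOrderAt_nonneg_iff_analyticAt).mp (not_lt.mp h)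

lemma AnalyticAt.not_isPole {z : ℂ} (h : AnalyticAt ℂ V z) : ¬ IsPole V z :=
  not_lt.mpr h.meromorphicOrderAt_nonneg

lemma PotentialClass.eventually_not_isPole (hV : PotentialClass R V) {z : ℂ} (hz : z ∈ strip R) :
    ∀ᶠ w in 𝓝[≠] z, ¬ IsPole V w := by
  filter_upwards [(hV.meromorphic hz).meromorphicAt.eventually_analyticAt] with w hw
  exact AnalyticAt.not_isPole hw

lemma tendsto_add_const_punctured (z b : ℂ) : Tendsto (fun w => w + b) (𝓝[≠] z) (𝓝[≠] (z + b)) := by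
  refine tendsto_nhdsWithin_iff.mpr ⟨?_, ?_⟩
  · exact ((continuous_id.add continuous_const).tendsto z).mono_left nhdsWithin_le_nhds
  · filter_upwards [self_mem_nhdsWithin] with w hw h
    exact hw (add_right_cancel h)

/-- The holomorphic extension of `1 / (V(z) - V(z - a))`. -/
lemma PotentialClass.exists_inv_difference (hV : PotentialClass R V) (hv : 0 < v)
    (hm : MonotoneConst R V v) {a : ℝ} (ha : 0 < torusNorm a) :
    ∃ g : ℂ → ℂ, HoloPer R g ∧ (∀ z ∈ strip R, ‖g z‖ ≤ (v * torusNorm a)⁻¹) ∧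
      ∀ z ∈ strip R, ¬ IsPole V z → ¬ IsPole V (z - a) → g z * (V z - V (z - a)) = 1 := by
  have hmer : ∀ b : ℝ, MeromorphicOn (fun z => V (z - b)) (strip R) := by
    intro b z hz
    have h1 := (hV.meromorphic (sub_real_mem_strip hz b)).meromorphicAt
    exact h1.comp_analyticAt (f := V) (g := fun z => z - b) (by fun_prop)
  have hpole : ∀ z ∈ strip R, ∀ b : ℝ, ∀ᶠ w in 𝓝[≠] z, ¬ IsPole V (w - b) := by
    intro z hz b
    have h0 : z + -(b : ℂ) ∈ strip R := by rw [← sub_eq_add_neg]; exact sub_real_mem_strip hz b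
    have h1 := (tendsto_add_const_punctured z (-b)).eventually (hV.eventually_not_isPole h0)
    simpa only [sub_eq_add_neg] using h1
  have hstrip : ∀ z ∈ strip R, ∀ᶠ w in 𝓝[≠] z, w ∈ strip R := fun z hz =>
    nhdsWithin_le_nhds ((isOpen_strip R).mem_nhds hz)
  have hmer' : MeromorphicOn (fun z => V z - V (z - a)) (strip R) := by
    have h0 : MeromorphicOn V (strip R) := fun z hz => (hV.meromorphic hz).meromorphicAt
    exact h0.sub (hmer a)
  obtain ⟨g, hg1, hg2, hg3, hg4⟩ := exists_holomorphic_inv (U := strip R)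
    (h := fun z => V z - V (z - a)) (mul_pos hv ha) hmer' (fun z hz => by
      filter_upwards [hstrip z hz, hpole z hz a, hV.eventually_not_isPole hz] with w hw h1 h2
      exact hm w hw a h2 h1)
  refine ⟨g, ⟨hg1, fun z hz => ?_⟩, hg2, fun z hz h1 h2 => hg4 z hz ?_⟩
  -- The function `g` is known to be the reciprocal only off a discrete set, so periodicity is
  -- checked in a punctured neighbourhood and passed to the limit.
  · have hz1 := add_one_mem_strip hz
    have c1 : Tendsto (fun w => g (w + 1)) (𝓝[≠] z) (𝓝 (g (z + 1))) :=
      (((hg1.differentiableAt ((isOpen_strip R).mem_nhds hz1)).continuousAt.tendsto).mono_left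
        nhdsWithin_le_nhds).comp (tendsto_add_const_punctured z 1)
    have c2 : Tendsto g (𝓝[≠] z) (𝓝 (g z)) :=
      ((hg1.differentiableAt ((isOpen_strip R).mem_nhds hz)).continuousAt.tendsto).mono_left
        nhdsWithin_le_nhds
    refine tendsto_nhds_unique c1 (c2.congr' ?_)
    filter_upwards [hstrip z hz, hg3 z hz,
      (tendsto_add_const_punctured z 1).eventually (hg3 _ hz1)] with w hw h1 h2
    rw [h1, h2, hV.periodic w hw]
    have := hV.periodic (w - a) (sub_real_mem_strip hw a)
    rw [show w + 1 - (a : ℂ) = w - a + 1 by ring, this]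
  · have k1 := (hV.analyticAt hz h1).continuousAt
    have k2 : ContinuousAt (fun z : ℂ => V (z - a)) z :=
      ContinuousAt.comp' (hV.analyticAt (sub_real_mem_strip hz a) h2).continuousAt (by fun_prop)
    exact k1.sub k2

end Potential

/-! ### The algebra of kernels with exponential weights -/

section Kernels

variable {d : ℕ}

/-- The supremum of `|f|` over the strip of half-width `r`. -/
def supE (r : ℝ) (f : ℂ → ℂ) : ℝ≥0∞ := ⨆ z ∈ strip r, ‖f z‖ₑ

lemma enorm_le_supE {r : ℝ} {z : ℂ} (hz : z ∈ strip r) (f : ℂ → ℂ) : ‖f z‖ₑ ≤ supE r f :=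
  le_iSup₂ (f := fun z (_ : z ∈ strip r) => ‖f z‖ₑ) z hz

lemma supE_le {r : ℝ} {f : ℂ → ℂ} {C : ℝ≥0∞} (h : ∀ z ∈ strip r, ‖f z‖ₑ ≤ C) : supE r f ≤ C :=
  iSup₂_le h

/-- The exponential weight `e^{ρ|n|}`. -/
def expWeight (ρ : ℝ) (n : Lattice d) : ℝ≥0∞ := ENNReal.ofReal (Real.exp (ρ * ‖n‖))

lemma one_le_expWeight {ρ : ℝ} (hρ : 0 ≤ ρ) (n : Lattice d) : 1 ≤ expWeight ρ n := by
  rw [expWeight, ENNReal.one_le_ofReal]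
  exact Real.one_le_exp (by positivity)

lemma expWeight_le_mul {ρ : ℝ} (hρ : 0 ≤ ρ) (l n : Lattice d) :
    expWeight ρ n ≤ expWeight ρ l * expWeight ρ (n - l) := by
  rw [expWeight, expWeight, expWeight, ← ENNReal.ofReal_mul (Real.exp_pos _).le, ← Real.exp_add]
  apply ENNReal.ofReal_le_ofReal
  rw [Real.exp_le_exp, ← mul_add]
  refine mul_le_mul_of_nonneg_left ?_ hρ
  simpa using norm_add_le l (n - l)

lemma expWeight_mono {ρ ρ' : ℝ} (h : ρ' ≤ ρ) (n : Lattice d) : expWeight ρ' n ≤ expWeight ρ n := by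
  unfold expWeight
  gcongr

/-- The norm `∑_n sup_{strip r} |A(·,n)| e^{ρ|n|}` of a kernel. -/
def expNorm (r ρ : ℝ) (A : ℂ → Lattice d → ℂ) : ℝ≥0∞ :=
  ∑' n, supE r (fun z => A z n) * expWeight ρ n

/-- The twisted convolution of kernels, corresponding to the composition of operators. -/
def kmul (ω : Fin d → ℝ) (A B : ℂ → Lattice d → ℂ) : ℂ → Lattice d → ℂ :=
  fun z n => ∑' l, A z l * B (z - dotFreq l ω) (n - l)

/-- The kernel of the identity. -/
def kone : ℂ → Lattice d → ℂ := fun _ n => if n = 0 then 1 else 0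

/-- Periodic holomorphic kernels of exponential norm at most `C`. -/
structure KerBound (r ρ : ℝ) (A : ℂ → Lattice d → ℂ) (C : ℝ) : Prop where
  holo : ∀ n, HoloPer r fun z => A z n
  bound : expNorm r ρ A ≤ ENNReal.ofReal C

variable {r ρ C C' : ℝ} {ω : Fin d → ℝ} {A B : ℂ → Lattice d → ℂ}

lemma KerBound.mono {r' ρ' : ℝ} (h : KerBound r ρ A C) (hr : r' ≤ r) (hρ : ρ' ≤ ρ) (hC : C ≤ C') :
    KerBound r' ρ' A C' := by
  refine ⟨fun n => (h.holo n).mono hr, le_trans ?_ (h.bound.trans (ENNReal.ofReal_le_ofReal hC))⟩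
  refine ENNReal.tsum_le_tsum fun n => mul_le_mul' ?_ (expWeight_mono hρ n)
  exact supE_le fun z hz => enorm_le_supE (f := fun z => A z n) (strip_mono hr hz)

lemma KerBound.weaken (h : KerBound r ρ A C) (hC : C ≤ C') : KerBound r ρ A C' :=
  h.mono le_rfl le_rfl hC

lemma tsum_supE_le (hρ : 0 ≤ ρ) : ∑' n, supE r (fun z => A z n) ≤ expNorm r ρ A :=
  ENNReal.tsum_le_tsum fun n => le_mul_of_one_le_right' (one_le_expWeight hρ n)

lemma supE_le_expNorm (hρ : 0 ≤ ρ) (n : Lattice d) :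
    supE r (fun z => A z n) ≤ expNorm r ρ A :=
  (ENNReal.le_tsum n).trans (tsum_supE_le hρ)

lemma tsum_enorm_le {z : ℂ} (hz : z ∈ strip r) (hρ : 0 ≤ ρ) :
    ∑' n, ‖A z n‖ₑ ≤ expNorm r ρ A :=
  (ENNReal.tsum_le_tsum fun n => enorm_le_supE hz fun z => A z n).trans (tsum_supE_le hρ)

lemma KerBound.summable_norm (h : KerBound r ρ A C) (hρ : 0 ≤ ρ) {z : ℂ} (hz : z ∈ strip r) :
    Summable fun n => ‖A z n‖ := by
  rw [← tsum_enorm_ne_top_iff_summable_norm]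
  exact ne_top_of_le_ne_top ENNReal.ofReal_ne_top ((tsum_enorm_le hz hρ).trans h.bound)

lemma KerBound.norm_le_exp (h : KerBound r ρ A C) (hC : 0 ≤ C) {z : ℂ} (hz : z ∈ strip r)
    (n : Lattice d) : ‖A z n‖ ≤ C * Real.exp (-(ρ * ‖n‖)) := by
  have h1 : ‖A z n‖ₑ * expWeight ρ n ≤ ENNReal.ofReal C :=
    (mul_le_mul_left (enorm_le_supE hz fun z => A z n) _).trans ((ENNReal.le_tsum n).trans h.bound)
  rw [expWeight, ← ofReal_norm, ← ENNReal.ofReal_mul (norm_nonneg _),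
    ENNReal.ofReal_le_ofReal_iff hC] at h1
  rw [Real.exp_neg, ← div_eq_mul_inv, le_div_iff₀ (Real.exp_pos _)]
  exact h1

lemma KerBound.norm_le (h : KerBound r ρ A C) (hρ : 0 ≤ ρ) (hC : 0 ≤ C) {z : ℂ} (hz : z ∈ strip r)
    (n : Lattice d) : ‖A z n‖ ≤ C := by
  refine (h.norm_le_exp hC hz n).trans (mul_le_of_le_one_right hC ?_)
  rw [Real.exp_le_one_iff]
  have := norm_nonneg n
  nlinarith [mul_nonneg hρ this]

lemma KerBound.add (hA : KerBound r ρ A C) (hB : KerBound r ρ B C') (hC : 0 ≤ C) (hC' : 0 ≤ C') :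
    KerBound r ρ (A + B) (C + C') := by
  refine ⟨fun n => ⟨(hA.holo n).diff.add (hB.holo n).diff, fun z hz => ?_⟩, ?_⟩
  · show A (z + 1) n + B (z + 1) n = A z n + B z n
    rw [(hA.holo n).per z hz, (hB.holo n).per z hz]
  · rw [ENNReal.ofReal_add hC hC']
    refine le_trans ?_ (add_le_add hA.bound hB.bound)
    rw [expNorm, expNorm, expNorm, ← ENNReal.tsum_add]
    refine ENNReal.tsum_le_tsum fun n => ?_
    rw [← add_mul]
    gcongr
    refine supE_le fun z hz => (enorm_add_le _ _).trans ?_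
    exact add_le_add (enorm_le_supE hz fun z => A z n) (enorm_le_supE hz fun z => B z n)

/-- Entrywise factors growing like e^{(ρ-ρ')|n|} are paid for by lowering the rate from ρ to ρ'.
This is how division by the small divisors enters the estimates. -/
lemma KerBound.mul_multiplier {ρ' b : ℝ} (hA : KerBound r ρ A C) {m : Lattice d → ℂ → ℂ}
    (hm : ∀ n, HoloPer r (m n)) (hb : 0 ≤ b)
    (hmb : ∀ n, ∀ z ∈ strip r, ‖m n z‖ ≤ b * Real.exp ((ρ - ρ') * ‖n‖)) :
    KerBound r ρ' (fun z n => A z n * m n z) (b * C) := by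
  refine ⟨fun n => ⟨(hA.holo n).diff.mul (hm n).diff, fun z hz => ?_⟩, ?_⟩
  · show A (z + 1) n * m n (z + 1) = A z n * m n z
    rw [(hA.holo n).per z hz, (hm n).per z hz]
  · rw [ENNReal.ofReal_mul hb]
    refine le_trans ?_ (mul_le_mul_right hA.bound _)
    rw [expNorm, expNorm, ← ENNReal.tsum_mul_left]
    refine ENNReal.tsum_le_tsum fun n => ?_
    have h1 : supE r (fun z => A z n * m n z) ≤
        supE r (fun z => A z n) * ENNReal.ofReal (b * Real.exp ((ρ - ρ') * ‖n‖)) := by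
      refine supE_le fun z hz => ?_
      rw [enorm_mul]
      refine mul_le_mul' (enorm_le_supE hz fun z => A z n) ?_
      rw [← ofReal_norm]
      exact ENNReal.ofReal_le_ofReal (hmb n z hz)
    refine (mul_le_mul_left h1 _).trans_eq ?_
    rw [expWeight, expWeight, mul_assoc, ← ENNReal.ofReal_mul (by positivity), mul_left_comm,
      ← ENNReal.ofReal_mul hb, mul_assoc b, ← Real.exp_add]
    congr 4
    ring

lemma KerBound.neg (hA : KerBound r ρ A C) : KerBound r ρ (-A) C := by
  have h := hA.mul_multiplier (ρ' := ρ) (m := fun _ _ => -1) (b := 1)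
    (fun n => ⟨differentiableOn_const _, fun _ _ => rfl⟩) zero_le_one (by simp)
  rw [one_mul] at h
  convert h using 3
  simp

lemma enorm_kmul_le {z : ℂ} (hz : z ∈ strip r) (n : Lattice d) :
    ‖kmul ω A B z n‖ₑ ≤ ∑' l, supE r (fun z => A z l) * supE r (fun z => B z (n - l)) := by
  refine enorm_tsum_le_tsum_enorm.trans (ENNReal.tsum_le_tsum fun l => ?_)
  rw [enorm_mul]
  exact mul_le_mul' (enorm_le_supE hz fun z => A z l)
    (enorm_le_supE (sub_real_mem_strip hz _) fun z => B z (n - l))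

/-- The weight is submultiplicative, and the real shift of the phase in the second factor does not
affect suprema over a strip. What remains is an ordinary ℓ¹ convolution. -/
lemma expNorm_kmul_le (hρ : 0 ≤ ρ) :
    expNorm r ρ (kmul ω A B) ≤ expNorm r ρ A * expNorm r ρ B := by
  calc expNorm r ρ (kmul ω A B)
      ≤ ∑' n, ∑' l, (supE r (fun z => A z l) * expWeight ρ l) *
          (supE r (fun z => B z (n - l)) * expWeight ρ (n - l)) := by
        refine ENNReal.tsum_le_tsum fun n => ?_
        refine (mul_le_mul_left (supE_le fun z hz => enorm_kmul_le hz n) _).trans ?_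
        rw [← ENNReal.tsum_mul_right]
        refine ENNReal.tsum_le_tsum fun l => ?_
        rw [mul_mul_mul_comm]
        exact mul_le_mul_right (expWeight_le_mul hρ l n) _
    _ = ∑' l, ∑' n, (supE r (fun z => A z l) * expWeight ρ l) *
          (supE r (fun z => B z (n - l)) * expWeight ρ (n - l)) := ENNReal.tsum_comm
    _ = ∑' l, (supE r (fun z => A z l) * expWeight ρ l) * expNorm r ρ B := by
        refine tsum_congr fun l => ?_
        rw [ENNReal.tsum_mul_left]
        congr 1
        exact (Equiv.subRight l).tsum_eq fun n => supE r (fun z => B z n) * expWeight ρ n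
    _ = expNorm r ρ A * expNorm r ρ B := ENNReal.tsum_mul_right

lemma KerBound.summable_kmul (hA : KerBound r ρ A C) (hB : KerBound r ρ B C') (hρ : 0 ≤ ρ)
    {z : ℂ} (hz : z ∈ strip r) (n : Lattice d) :
    Summable fun l => ‖A z l * B (z - dotFreq l ω) (n - l)‖ := by
  refine Summable.of_nonneg_of_le (fun _ => norm_nonneg _) (fun l => ?_)
    ((hA.summable_norm hρ hz).mul_right (max C' 0))
  rw [norm_mul]
  gcongr
  exact (hB.weaken (le_max_left C' 0)).norm_le hρ (le_max_right _ _) (sub_real_mem_strip hz _) _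

lemma KerBound.hasSum_kmul (hA : KerBound r ρ A C) (hB : KerBound r ρ B C') (hρ : 0 ≤ ρ)
    {z : ℂ} (hz : z ∈ strip r) (n : Lattice d) :
    HasSum (fun l => A z l * B (z - dotFreq l ω) (n - l)) (kmul ω A B z n) :=
  (hA.summable_kmul hB hρ hz n).of_norm.hasSum

lemma KerBound.kmul (hA : KerBound r ρ A C) (hB : KerBound r ρ B C') (hρ : 0 ≤ ρ) (hC : 0 ≤ C) :
    KerBound r ρ (kmul ω A B) (C * C') := by
  refine ⟨fun n => ⟨?_, fun z hz => ?_⟩, ?_⟩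
  · have hs : Summable fun l => (supE r fun z => A z l).toReal * max C' 0 := by
      refine (ENNReal.summable_toReal ?_).mul_right _
      exact ne_top_of_le_ne_top ENNReal.ofReal_ne_top ((tsum_supE_le hρ).trans hA.bound)
    refine Complex.differentiableOn_tsum_of_summable_norm hs (fun l => ?_) (isOpen_strip r)
      fun l z hz => ?_
    · refine (hA.holo l).diff.mul ((hB.holo (n - l)).diff.comp
        (differentiableOn_id.sub_const _) fun z hz => sub_real_mem_strip hz _)
    · rw [norm_mul]
      gcongr
      · have h1 : supE r (fun z => A z l) ≠ ⊤ :=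
          ne_top_of_le_ne_top ENNReal.ofReal_ne_top ((supE_le_expNorm hρ l).trans hA.bound)
        rw [← toReal_enorm]
        exact ENNReal.toReal_mono h1 (enorm_le_supE hz fun z => A z l)
      · exact (hB.weaken (le_max_left C' 0)).norm_le hρ (le_max_right _ _)
          (sub_real_mem_strip hz _) _
  · refine tsum_congr fun l => ?_
    rw [(hA.holo l).per z hz, add_sub_right_comm,
      (hB.holo (n - l)).per _ (sub_real_mem_strip hz _)]
  · rw [ENNReal.ofReal_mul hC]
    exact (expNorm_kmul_le hρ).trans (mul_le_mul' hA.bound hB.bound)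

lemma kone_kmul (A : ℂ → Lattice d → ℂ) : kmul ω kone A = A := by
  funext z n
  rw [kmul, tsum_eq_single 0 fun l hl => by simp [kone, hl]]
  simp [kone]

lemma KerBound.kone : KerBound r ρ (kone (d := d)) 1 := by
  refine ⟨fun n => ⟨differentiableOn_const _, fun _ _ => rfl⟩, ?_⟩
  rw [expNorm, tsum_eq_single 0 fun n hn => ?_]
  · rw [ENNReal.ofReal_one, expWeight]
    simpa using supE_le (r := r) (f := fun z => PowerLaw.kone (d := d) z 0) (C := 1)
      (by simp [PowerLaw.kone])
  · have : supE r (fun _ => (0 : ℂ)) = 0 := le_antisymm (supE_le (by simp)) bot_le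
    simp [PowerLaw.kone, hn, this]

lemma KerBound.add_kmul {A' : ℂ → Lattice d → ℂ} {C₂ : ℝ} (hA : KerBound r ρ A C)
    (hA' : KerBound r ρ A' C₂) (hB : KerBound r ρ B C') (hρ : 0 ≤ ρ) {z : ℂ} (hz : z ∈ strip r)
    (n : Lattice d) :
    PowerLaw.kmul ω (A + A') B z n = PowerLaw.kmul ω A B z n + PowerLaw.kmul ω A' B z n := by
  refine (HasSum.tsum_eq ?_)
  simpa [add_mul] using (hA.hasSum_kmul (ω := ω) hB hρ hz n).add (hA'.hasSum_kmul hB hρ hz n)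

lemma KerBound.kmul_add {B' : ℂ → Lattice d → ℂ} {C₂ : ℝ} (hA : KerBound r ρ A C)
    (hB : KerBound r ρ B C') (hB' : KerBound r ρ B' C₂) (hρ : 0 ≤ ρ) {z : ℂ} (hz : z ∈ strip r)
    (n : Lattice d) :
    PowerLaw.kmul ω A (B + B') z n = PowerLaw.kmul ω A B z n + PowerLaw.kmul ω A B' z n := by
  refine (HasSum.tsum_eq ?_)
  simpa [mul_add] using (hA.hasSum_kmul (ω := ω) hB hρ hz n).add (hA.hasSum_kmul hB' hρ hz n)

/-- Associativity of the twisted convolution. -/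
lemma KerBound.kmul_assoc {D : ℂ → Lattice d → ℂ} {C₂ : ℝ} (hA : KerBound r ρ A C)
    (hB : KerBound r ρ B C') (hD : KerBound r ρ D C₂) (hρ : 0 ≤ ρ) {z : ℂ} (hz : z ∈ strip r)
    (n : Lattice d) :
    PowerLaw.kmul ω (PowerLaw.kmul ω A B) D z n = PowerLaw.kmul ω A (PowerLaw.kmul ω B D) z n := by
  set F : Lattice d → Lattice d → ℂ := fun k l =>
    A z k * B (z - dotFreq k ω) (l - k) * D (z - dotFreq l ω) (n - l) with hF
  have hsum : Summable (Function.uncurry F) := by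
    have h1 : Summable fun p : Lattice d × Lattice d => ‖Function.uncurry F p‖ := by
      rw [← tsum_enorm_ne_top_iff_summable_norm, ENNReal.tsum_prod']
      have : ∀ k l, ‖Function.uncurry F (k, l)‖ₑ ≤
          ‖A z k‖ₑ * (‖B (z - dotFreq k ω) (l - k)‖ₑ * expNorm r ρ D) := by
        intro k l
        simp only [Function.uncurry, hF, enorm_mul, mul_assoc]
        gcongr
        exact (enorm_le_supE (sub_real_mem_strip hz _) fun z => D z (n - l)).trans
          (supE_le_expNorm hρ _)
      refine ne_top_of_le_ne_top (b := expNorm r ρ A * (expNorm r ρ B * expNorm r ρ D)) ?_ ?_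
      · exact ENNReal.mul_ne_top (ne_top_of_le_ne_top ENNReal.ofReal_ne_top hA.bound)
          (ENNReal.mul_ne_top (ne_top_of_le_ne_top ENNReal.ofReal_ne_top hB.bound)
            (ne_top_of_le_ne_top ENNReal.ofReal_ne_top hD.bound))
      · refine (ENNReal.tsum_le_tsum fun k => ENNReal.tsum_le_tsum fun l => this k l).trans ?_
        simp_rw [ENNReal.tsum_mul_left, ENNReal.tsum_mul_right]
        refine le_trans (ENNReal.tsum_le_tsum fun k => ?_) (ENNReal.tsum_mul_right.trans_le
          (mul_le_mul_left (tsum_enorm_le hz hρ) _))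
        gcongr
        exact ((Equiv.subRight k).tsum_eq fun l => ‖B (z - dotFreq k ω) l‖ₑ).trans_le
          (tsum_enorm_le (sub_real_mem_strip hz _) hρ)
    exact h1.of_norm
  calc PowerLaw.kmul ω (PowerLaw.kmul ω A B) D z n = ∑' l, ∑' k, F k l := by
        refine tsum_congr fun l => ?_
        rw [PowerLaw.kmul, ← tsum_mul_right]
    _ = ∑' k, ∑' l, F k l := hsum.tsum_comm
    _ = PowerLaw.kmul ω A (PowerLaw.kmul ω B D) z n := by
        refine tsum_congr fun k => ?_
        rw [PowerLaw.kmul, ← tsum_mul_left, ← (Equiv.addRight k).tsum_eq]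
        refine tsum_congr fun l => ?_
        simp only [hF, Equiv.coe_addRight]
        rw [add_sub_cancel_right, add_comm l k, ← sub_dotFreq_add, ← sub_sub n, mul_assoc]

end Kernels

/-! ### Interchanging the supremum over the phase with the lattice sum -/

section Average

/-- In Cauchy's formula the factor ρ/|ζ - w| is at most 2 for w in the disc of half radius, and
1/(2π) ≤ 1 is dropped. Unlike a supremum, the resulting integral commutes with sums over the
lattice. -/
lemma enorm_le_circle_average {f : ℂ → ℂ} {c w : ℂ} {ρ : ℝ} (hρ : 0 < ρ)
    (hf : DifferentiableOn ℂ f (Metric.closedBall c ρ)) (hw : w ∈ Metric.ball c (ρ / 2)) :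
    ‖f w‖ₑ ≤ 2 * ∫⁻ θ in Set.Ioc 0 (2 * Real.pi), ‖f (circleMap c ρ θ)‖ₑ := by
  have hw' : w ∈ Metric.ball c ρ := Metric.ball_subset_ball (by linarith) hw
  have hC := Complex.two_pi_I_inv_smul_circleIntegral_sub_inv_smul_of_differentiable_on_off_countable
    (s := ∅) Set.countable_empty hw' hf.continuousOn fun x hx =>
      (hf.mono Metric.ball_subset_closedBall).differentiableAt (Metric.isOpen_ball.mem_nhds hx.1)
  rw [← hC, enorm_smul]
  have h1 : ‖((2 * Real.pi * Complex.I)⁻¹ : ℂ)‖ₑ ≤ 1 := by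
    rw [← ofReal_norm, ENNReal.ofReal_le_one, norm_inv]
    refine inv_le_one_of_one_le₀ ?_
    have := Real.pi_gt_three
    simp only [norm_mul, Complex.norm_ofNat, Complex.norm_real, Complex.norm_I, Real.norm_eq_abs,
      abs_of_pos Real.pi_pos]
    linarith
  refine (mul_le_of_le_one_left' h1).trans ?_
  rw [circleIntegral, intervalIntegral.integral_of_le (by positivity)]
  refine (enorm_integral_le_lintegral_enorm _).trans ?_
  rw [← lintegral_const_mul' _ _ (by simp)]
  refine lintegral_mono fun θ => ?_
  rw [smul_smul, enorm_smul]
  gcongr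
  rw [← ofReal_norm, show (2 : ℝ≥0∞) = ENNReal.ofReal 2 by simp]
  apply ENNReal.ofReal_le_ofReal
  rw [norm_mul, norm_inv, deriv_circleMap, norm_mul, Complex.norm_I, mul_one, norm_circleMap_zero,
    abs_of_pos hρ, ← div_eq_mul_inv]
  have h2 : ρ / 2 ≤ ‖circleMap c ρ θ - w‖ := by
    have h3 : ‖circleMap c ρ θ - c‖ = ρ := by
      have := circleMap_mem_sphere c hρ.le θ
      rwa [mem_sphere_iff_norm] at this
    have h4 : ‖w - c‖ < ρ / 2 := by rwa [← mem_ball_iff_norm]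
    have h5 := norm_sub_le_norm_sub_add_norm_sub (circleMap c ρ θ) w c
    linarith
  rw [div_le_iff₀ (by linarith)]
  linarith

/-- On a smaller strip the sum over the lattice may be taken after the supremum over the phase. -/
lemma exists_tsum_supE_le {R : ℝ} (hR : 0 < R) :
    ∃ C : ℝ, 0 < C ∧ ∀ (d : ℕ) (s : ℝ) (M : ℂ → Lattice d → ℂ), KernelSpace R s M →
      ∑' n, supE (3 * R / 4) (fun z => M z n) * ENNReal.ofReal (bracket n ^ s) ≤
        ENNReal.ofReal (C * kernelNorm R s M) := by
  -- One period of the closed strip is covered by finitely many discs of radius R/16. The concentric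
  -- circles of radius R/8 stay in `strip R` because 3/4 + 1/8 < 1, so the constant depends on R
  -- only.
  set K : Set ℂ := Set.Icc 0 1 ×ℂ Set.Icc (-(3 * R / 4)) (3 * R / 4) with hK
  have hKc : IsCompact K := isCompact_Icc.reProdIm isCompact_Icc
  obtain ⟨t, htK, htf, htc⟩ := finite_cover_balls_of_compact hKc (e := R / 8 / 2) (by positivity)
  set T := htf.toFinset with hT
  set C : ℝ := T.card * (2 * (2 * Real.pi)) + 1 with hCdef
  have hball : ∀ c ∈ T, Metric.closedBall c (R / 8) ⊆ strip R := by
    intro c hc u hu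
    have hcK : c ∈ K := htK (htf.mem_toFinset.mp hc)
    have h0 := hcK.2
    simp only [Set.mem_preimage, Set.mem_Icc] at h0
    have h1 : |(u - c).im| ≤ R / 8 :=
      (Complex.abs_im_le_norm _).trans (by simpa [dist_eq_norm] using hu)
    rw [Complex.sub_im, abs_le] at h1
    show |u.im| < R
    rw [abs_lt]
    constructor <;> linarith
  refine ⟨C, by positivity, fun d s M hM => ?_⟩
  have hsup : ∀ n, supE (3 * R / 4) (fun z => M z n) ≤
      ∑ c ∈ T, 2 * ∫⁻ θ in Set.Ioc 0 (2 * Real.pi), ‖M (circleMap c (R / 8) θ) n‖ₑ := by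
    intro n
    refine supE_le fun z hz => ?_
    have hzs : z ∈ strip R := strip_mono (by linarith) hz
    rw [← periodic_int (f := fun z => M z n) (hM.holo n).periodic hzs ⌊z.re⌋]
    have hzK : z - (⌊z.re⌋ : ℂ) ∈ K := by
      have h2 : -(3 * R / 4) < z.im ∧ z.im < 3 * R / 4 := abs_lt.mp hz
      refine ⟨?_, ?_⟩
      · simp only [Set.mem_preimage, Complex.sub_re, Complex.intCast_re, Set.mem_Icc]
        exact ⟨by linarith [Int.floor_le z.re], by linarith [Int.lt_floor_add_one z.re]⟩
      · simp only [Set.mem_preimage, Complex.sub_im, Complex.intCast_im, Set.mem_Icc]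
        constructor <;> linarith
    obtain ⟨c, hct, hcb⟩ := Set.mem_iUnion₂.mp (htc hzK)
    have hcT : c ∈ T := htf.mem_toFinset.mpr hct
    refine (enorm_le_circle_average (f := fun z => M z n) (by positivity)
      ((hM.holo n).holomorphic.mono (hball c hcT)) hcb).trans ?_
    exact Finset.single_le_sum (f := fun c => 2 * ∫⁻ θ in Set.Ioc 0 (2 * Real.pi),
      ‖M (circleMap c (R / 8) θ) n‖ₑ) (fun _ _ => zero_le) hcT
  have hmeas : ∀ c ∈ T, ∀ n, AEMeasurable (fun θ => ‖M (circleMap c (R / 8) θ) n‖ₑ *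
      ENNReal.ofReal (bracket n ^ s)) (volume.restrict (Set.Ioc 0 (2 * Real.pi))) := by
    intro c hc n
    have h1 : Continuous fun θ => M (circleMap c (R / 8) θ) n :=
      (hM.holo n).holomorphic.continuousOn.comp_continuous (continuous_circleMap _ _) fun θ =>
        hball c hc (Metric.sphere_subset_closedBall (circleMap_mem_sphere c (by positivity) θ))
    exact (h1.enorm.measurable.mul_const _).aemeasurable
  calc ∑' n, supE (3 * R / 4) (fun z => M z n) * ENNReal.ofReal (bracket n ^ s)
      ≤ ∑' n, ∑ c ∈ T, 2 * ∫⁻ θ in Set.Ioc 0 (2 * Real.pi), ‖M (circleMap c (R / 8) θ) n‖ₑ *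
          ENNReal.ofReal (bracket n ^ s) := by
        refine ENNReal.tsum_le_tsum fun n => (mul_le_mul_left (hsup n) _).trans_eq ?_
        rw [Finset.sum_mul]
        refine Finset.sum_congr rfl fun c _ => ?_
        rw [lintegral_mul_const' _ _ ENNReal.ofReal_ne_top, mul_assoc]
    _ = ∑ c ∈ T, 2 * ∫⁻ θ in Set.Ioc 0 (2 * Real.pi), ∑' n, ‖M (circleMap c (R / 8) θ) n‖ₑ *
          ENNReal.ofReal (bracket n ^ s) := by
        rw [Summable.tsum_finsetSum fun _ _ => ENNReal.summable]
        refine Finset.sum_congr rfl fun c hc => ?_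
        rw [ENNReal.tsum_mul_left, lintegral_tsum (hmeas c hc)]
    _ ≤ ∑ c ∈ T, 2 * ∫⁻ _ in Set.Ioc 0 (2 * Real.pi), kernelENorm R s M := by
        refine Finset.sum_le_sum fun c hc => ?_
        gcongr with θ
        have hz : circleMap c (R / 8) θ ∈ strip R :=
          hball c hc (Metric.sphere_subset_closedBall (circleMap_mem_sphere c (by positivity) θ))
        refine le_trans (ENNReal.tsum_le_tsum fun n => ?_)
          (le_iSup₂ (f := fun z (_ : z ∈ strip R) =>
            ∑' n, ENNReal.ofReal (‖M z n‖ * bracket n ^ s)) _ hz)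
        rw [ENNReal.ofReal_mul (norm_nonneg _), ofReal_norm]
    _ = ENNReal.ofReal (T.card * (2 * (2 * Real.pi)) * kernelNorm R s M) := by
        have hπ : 0 ≤ 2 * Real.pi := by positivity
        rw [lintegral_const, Measure.restrict_apply_univ, Real.volume_Ioc, sub_zero,
          Finset.sum_const, nsmul_eq_mul, kernelNorm]
        generalize 2 * Real.pi = x at hπ
        rw [ENNReal.ofReal_mul (by positivity), ENNReal.ofReal_toReal hM.finite.ne,
          ENNReal.ofReal_mul (by positivity), ENNReal.ofReal_mul (by norm_num),
          ENNReal.ofReal_natCast, ENNReal.ofReal_ofNat]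
        ring
    _ ≤ ENNReal.ofReal (C * kernelNorm R s M) := by
        apply ENNReal.ofReal_le_ofReal
        have : 0 ≤ kernelNorm R s M := ENNReal.toReal_nonneg
        gcongr
        linarith

end Average

/-! ### Dyadic truncation and the divisors of the perturbed potential -/

section Iteration

variable {d : ℕ}

/-- The truncation of a kernel to `⟨n⟩ < 2^j`. -/
def truncKer (M : ℂ → Lattice d → ℂ) (j : ℕ) : ℂ → Lattice d → ℂ :=
  fun z n => if bracket n < 2 ^ j then M z n else 0

/-- Since brackets are at least 1 = 2^0, nothing survives at j = 0. The iteration therefore starts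
from an exact solution: the identity kernel, no shift, no error. -/
lemma truncKer_zero (M : ℂ → Lattice d → ℂ) : truncKer M 0 = 0 := by
  funext z n
  simp [truncKer, one_le_bracket n]

lemma holoPer_zero (r : ℝ) : HoloPer r fun _ => 0 := ⟨differentiableOn_const _, fun _ _ => rfl⟩

lemma KerBound.zero (r ρ : ℝ) : KerBound r ρ (0 : ℂ → Lattice d → ℂ) 0 := by
  refine ⟨fun n => holoPer_zero r, ?_⟩
  have : supE r (fun _ => (0 : ℂ)) = 0 := le_antisymm (supE_le (by simp)) bot_le
  simp [expNorm, this]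

/-- Kernels with finite polynomial norm `∑ sup |M(·,n)| ⟨n⟩^s`. -/
structure PolyBound (r s : ℝ) (M : ℂ → Lattice d → ℂ) (ε : ℝ) : Prop where
  holo : ∀ n, HoloPer r fun z => M z n
  bound : ∑' n, supE r (fun z => M z n) * ENNReal.ofReal (bracket n ^ s) ≤ ENNReal.ofReal ε

/-- A qualitative bound: it serves to justify associativity and distributivity of convolutions with
the truncation, and its constant enters no estimate of the iteration. -/
lemma PolyBound.truncKer {r s ε ρ : ℝ} {M : ℂ → Lattice d → ℂ} (hM : PolyBound r s M ε) (j : ℕ)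
    (hs : 0 ≤ s) (hρ : 0 ≤ ρ) :
    KerBound r ρ (truncKer M j) (Real.exp (ρ * 2 ^ j) * ε) := by
  refine ⟨fun n => ?_, ?_⟩
  · by_cases h : bracket n < 2 ^ j
    · simpa [PowerLaw.truncKer, h] using hM.holo n
    · simpa [PowerLaw.truncKer, h] using holoPer_zero r
  · rw [ENNReal.ofReal_mul (Real.exp_pos _).le]
    refine le_trans ?_ (mul_le_mul_right hM.bound _)
    rw [← ENNReal.tsum_mul_left]
    refine ENNReal.tsum_le_tsum fun n => ?_
    by_cases h : bracket n < 2 ^ j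
    · simp only [PowerLaw.truncKer, h, if_true]
      rw [mul_left_comm, expWeight, ← ENNReal.ofReal_mul (Real.exp_pos _).le]
      gcongr
      rw [← mul_one (Real.exp (ρ * ‖n‖))]
      have h1 := (norm_le_bracket n).trans h.le
      have h2 := Real.one_le_rpow (one_le_bracket n) hs
      gcongr
    · simp only [PowerLaw.truncKer, h, if_false]
      have : supE r (fun _ => (0 : ℂ)) = 0 := le_antisymm (supE_le (by simp)) bot_le
      simp [this]

/-- The difference lives on the shell 2^j ≤ ⟨n⟩ < 2^{j+1}. There the exponential weight is at most
e, while 2^{-sj}⟨n⟩^s ≥ 1. -/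
lemma PolyBound.truncKer_sub {r s ε : ℝ} {M : ℂ → Lattice d → ℂ} (hM : PolyBound r s M ε) (j : ℕ)
    (hs : 0 ≤ s) :
    KerBound r ((1 / 2) ^ (j + 1)) (PowerLaw.truncKer M (j + 1) - PowerLaw.truncKer M j)
      (Real.exp 1 * (2 ^ (-s)) ^ j * ε) := by
  have hval : ∀ z n, (PowerLaw.truncKer M (j + 1) - PowerLaw.truncKer M j) z n =
      if 2 ^ j ≤ bracket n ∧ bracket n < 2 ^ (j + 1) then M z n else 0 := by
    intro z n
    simp only [Pi.sub_apply, PowerLaw.truncKer]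
    have h2 : (2 : ℝ) ^ j ≤ 2 ^ (j + 1) := pow_le_pow_right₀ (by norm_num) (by omega)
    by_cases h : bracket n < 2 ^ j
    · simp [h, h.trans_le h2, not_le.mpr h]
    · simp [h, not_lt.mp h]
  refine ⟨fun n => ?_, ?_⟩
  · simp only [hval]
    split_ifs
    · exact hM.holo n
    · exact holoPer_zero r
  · rw [ENNReal.ofReal_mul (by positivity)]
    refine le_trans ?_ (mul_le_mul_right hM.bound _)
    rw [← ENNReal.tsum_mul_left]
    refine ENNReal.tsum_le_tsum fun n => ?_
    simp only [hval]
    by_cases h : 2 ^ j ≤ bracket n ∧ bracket n < 2 ^ (j + 1)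
    · simp only [h, and_self, if_true]
      rw [mul_left_comm, expWeight, ← ENNReal.ofReal_mul (by positivity)]
      gcongr
      have h1 : (1 / 2 : ℝ) ^ (j + 1) * ‖n‖ ≤ 1 := by
        calc (1 / 2 : ℝ) ^ (j + 1) * ‖n‖ ≤ (1 / 2 : ℝ) ^ (j + 1) * 2 ^ (j + 1) := by
              gcongr
              exact (norm_le_bracket n).trans h.2.le
          _ = 1 := by rw [← mul_pow]; norm_num
      have h2 : 1 ≤ ((2 : ℝ) ^ (-s)) ^ j * bracket n ^ s := by
        calc 1 = ((2 : ℝ) ^ (-s)) ^ j * ((2 : ℝ) ^ j) ^ s := by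
              rw [← Real.rpow_natCast, ← Real.rpow_mul (by norm_num), ← Real.rpow_natCast 2 j,
                ← Real.rpow_mul (by norm_num), ← Real.rpow_add (by norm_num)]
              rw [show -s * (j : ℝ) + j * s = 0 by ring, Real.rpow_zero]
          _ ≤ _ := by
              gcongr
              exact h.1
      calc Real.exp ((1 / 2 : ℝ) ^ (j + 1) * ‖n‖) ≤ Real.exp 1 * 1 := by
            rw [mul_one]; gcongr
        _ ≤ Real.exp 1 * (((2 : ℝ) ^ (-s)) ^ j * bracket n ^ s) := by gcongr
        _ = _ := by ring
    · simp only [h, if_false]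
      have : supE r (fun _ => (0 : ℂ)) = 0 := le_antisymm (supE_le (by simp)) bot_le
      simp [this]

/-- Holomorphic reciprocals of the small divisors `V(z) - V(z - n·ω)`. -/
structure DivisorInverse (R v : ℝ) (ω : Fin d → ℝ) (V : ℂ → ℂ) (g : Lattice d → ℂ → ℂ) : Prop where
  holo : ∀ n, n ≠ 0 → HoloPer R (g n)
  norm_le : ∀ n, n ≠ 0 → ∀ z ∈ strip R, ‖g n z‖ ≤ (v * torusNorm (dotFreq n ω))⁻¹
  mul_eq : ∀ n, n ≠ 0 → ∀ z ∈ strip R, ¬ IsPole V z → ¬ IsPole V (z - dotFreq n ω) →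
    g n z * (V z - V (z - dotFreq n ω)) = 1

/-- The reciprocals of the divisors of the perturbed potential `V + η`. -/
def perturbedInverse (ω : Fin d → ℝ) (g : Lattice d → ℂ → ℂ) (η : ℂ → ℂ) (n : Lattice d) (z : ℂ) :
    ℂ :=
  -- Expressing the reciprocal through `g` keeps it holomorphic at the poles of V. The value 0 at n
  -- = 0 gives the correction a vanishing diagonal; the diagonal of the error goes into the
  -- potential instead.
  if n = 0 then 0 else g n z / (1 + g n z * (η z - η (z - dotFreq n ω)))

section PerturbedInverse

variable {R v γ τ r : ℝ} {ω : Fin d → ℝ} {V η : ℂ → ℂ} {g : Lattice d → ℂ → ℂ}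

lemma torusNorm_dotFreq_pos (hγ : 0 < γ) (hω : ω ∈ DC d τ γ) {n : Lattice d} (hn : n ≠ 0) :
    0 < torusNorm (dotFreq n ω) :=
  (div_pos hγ (Real.rpow_pos_of_pos (bracket_pos n) _)).trans_le (hω.2 n hn)

/-- The bound 1/(v‖a‖) for the unperturbed reciprocal meets the variation (v/2)‖a‖ of η, so the
perturbation of 1 is at most 1/2. -/
lemma half_le_norm_perturbed (hg : DivisorInverse R v ω V g) (hv : 0 < v) (hγ : 0 < γ)
    (hω : ω ∈ DC d τ γ) (hr : r ≤ R)
    (hη : ∀ z ∈ strip r, ∀ a : ℝ, ‖η z - η (z - a)‖ ≤ v / 2 * torusNorm a) {n : Lattice d}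
    (hn : n ≠ 0) {z : ℂ} (hz : z ∈ strip r) :
    1 / 2 ≤ ‖1 + g n z * (η z - η (z - dotFreq n ω))‖ := by
  have ht := torusNorm_dotFreq_pos hγ hω hn
  have h1 : ‖g n z * (η z - η (z - dotFreq n ω))‖ ≤ 1 / 2 := by
    rw [norm_mul]
    calc _ ≤ (v * torusNorm (dotFreq n ω))⁻¹ * (v / 2 * torusNorm (dotFreq n ω)) := by
          gcongr
          · exact hg.norm_le n hn z (strip_mono hr hz)
          · exact hη z hz _
      _ = 1 / 2 := by field_simp
  have h2 := norm_sub_le (1 + g n z * (η z - η (z - dotFreq n ω)))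
    (g n z * (η z - η (z - dotFreq n ω)))
  rw [add_sub_cancel_right, norm_one] at h2
  linarith

lemma holoPer_perturbedInverse (hg : DivisorInverse R v ω V g) (hv : 0 < v) (hγ : 0 < γ)
    (hω : ω ∈ DC d τ γ) (hr : r ≤ R) (hηh : HoloPer r η)
    (hη : ∀ z ∈ strip r, ∀ a : ℝ, ‖η z - η (z - a)‖ ≤ v / 2 * torusNorm a) (n : Lattice d) :
    HoloPer r (perturbedInverse ω g η n) := by
  by_cases hn : n = 0
  · have : perturbedInverse ω g η n = fun _ => 0 := by funext z; simp [perturbedInverse, hn]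
    rw [this]
    exact holoPer_zero r
  · have : perturbedInverse ω g η n =
        fun z => g n z / (1 + g n z * (η z - η (z - dotFreq n ω))) := by
      funext z; simp [perturbedInverse, hn]
    rw [this]
    have hgn := (hg.holo n hn).mono hr
    refine ⟨hgn.diff.div (((hgn.diff).mul (hηh.diff.sub (hηh.diff.comp
      (differentiableOn_id.sub_const _) fun z hz => sub_real_mem_strip hz _))).const_add 1)
      fun z hz h0 => ?_, fun z hz => ?_⟩
    · have := half_le_norm_perturbed hg hv hγ hω hr hη hn hz
      rw [h0, norm_zero] at this
      norm_num at this
    · rw [hgn.per z hz, hηh.per z hz, add_sub_right_comm, hηh.per _ (sub_real_mem_strip hz _)]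

lemma norm_perturbedInverse_le (hg : DivisorInverse R v ω V g) (hv : 0 < v) (hγ : 0 < γ)
    (hω : ω ∈ DC d τ γ) (hr : r ≤ R)
    (hη : ∀ z ∈ strip r, ∀ a : ℝ, ‖η z - η (z - a)‖ ≤ v / 2 * torusNorm a) (n : Lattice d) {z : ℂ}
    (hz : z ∈ strip r) : ‖perturbedInverse ω g η n z‖ ≤ 2 * (v * γ)⁻¹ * bracket n ^ τ := by
  have hb := Real.rpow_pos_of_pos (bracket_pos n) τ
  by_cases hn : n = 0
  · rw [perturbedInverse, if_pos hn, norm_zero]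
    positivity
  · rw [perturbedInverse, if_neg hn, norm_div, div_le_iff₀
      (lt_of_lt_of_le (by norm_num) (half_le_norm_perturbed hg hv hγ hω hr hη hn hz))]
    have ht := torusNorm_dotFreq_pos hγ hω hn
    have h1 : ‖g n z‖ ≤ (v * γ)⁻¹ * bracket n ^ τ := by
      refine (hg.norm_le n hn z (strip_mono hr hz)).trans ?_
      have h2 : (v * torusNorm (dotFreq n ω))⁻¹ ≤ (v * (γ / bracket n ^ τ))⁻¹ := by
        gcongr
        exact hω.2 n hn
      refine h2.trans_eq ?_
      field_simp
    have h3 := half_le_norm_perturbed hg hv hγ hω hr hη hn hz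
    have h4 : 0 ≤ (v * γ)⁻¹ * bracket n ^ τ := by positivity
    nlinarith

lemma perturbedInverse_mul (hg : DivisorInverse R v ω V g) (hv : 0 < v) (hγ : 0 < γ)
    (hω : ω ∈ DC d τ γ) (hr : r ≤ R)
    (hη : ∀ z ∈ strip r, ∀ a : ℝ, ‖η z - η (z - a)‖ ≤ v / 2 * torusNorm a) {n : Lattice d}
    (hn : n ≠ 0) {z : ℂ} (hz : z ∈ strip r) (h1 : ¬ IsPole V z)
    (h2 : ¬ IsPole V (z - dotFreq n ω)) :
    perturbedInverse ω g η n z * ((V z + η z) - (V (z - dotFreq n ω) + η (z - dotFreq n ω))) =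
      1 := by
  rw [perturbedInverse, if_neg hn]
  have h3 : 1 + g n z * (η z - η (z - dotFreq n ω)) ≠ 0 := norm_pos_iff.mp
    (lt_of_lt_of_le (by norm_num) (half_le_norm_perturbed hg hv hγ hω hr hη hn hz))
  have h4 := hg.mul_eq n hn z (strip_mono hr hz) h1 h2
  rw [div_mul_eq_mul_div, div_eq_one_iff_eq h3]
  linear_combination h4

end PerturbedInverse

end Iteration

/-! ### The inductive step -/

section Step

variable {d : ℕ}

/-- The half-widths of the strips in the iteration. -/
def width (R : ℝ) (j : ℕ) : ℝ := R / 2 + R / 8 + R / 8 * (1 / 2) ^ j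

lemma width_sub (R : ℝ) (j : ℕ) : width R j - width R (j + 1) = R / 16 * (1 / 2) ^ j := by
  unfold width; ring

lemma width_succ_lt {R : ℝ} (hR : 0 < R) (j : ℕ) : width R (j + 1) < width R j := by
  have : 0 < R / 16 * (1 / 2) ^ j := by positivity
  linarith [width_sub R j]

lemma width_le {R : ℝ} (hR : 0 < R) (j : ℕ) : width R j ≤ 3 * R / 4 := by
  have : (1 / 2 : ℝ) ^ j ≤ 1 := pow_le_one₀ (by norm_num) (by norm_num)
  unfold width
  nlinarith

lemma le_width {R : ℝ} (hR : 0 < R) (j : ℕ) : R / 2 + R / 8 ≤ width R j := by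
  have : 0 ≤ R / 8 * (1 / 2) ^ j := by positivity
  unfold width
  linarith

/-- An approximate diagonalization `(V + M_j) U = U (V + η) + E`. -/
structure ApproxDiag (d : ℕ) where
  U : ℂ → Lattice d → ℂ
  η : ℂ → ℂ
  E : ℂ → Lattice d → ℂ

/-- The data of the iteration: frequency, potential, kernel, divisors, and the constants. -/
structure IterationData (R v γ τ s B κ ε : ℝ) (ω : Fin d → ℝ) (V : ℂ → ℂ)
    (M : ℂ → Lattice d → ℂ) (g : Lattice d → ℂ → ℂ) : Prop where
  hR : 0 < R
  hv : 0 < v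
  hγ : 0 < γ
  hτ : 1 ≤ τ
  hs : τ < s
  hB : 0 ≤ B
  hB1 : B ≤ 1
  hκ : 0 ≤ κ
  hε : 0 ≤ ε
  hω : ω ∈ DC d τ γ
  hg : DivisorInverse R v ω V g
  hM : PolyBound (3 * R / 4) s M ε
  -- The factor 2 bounds U and the rest bounds the linear correction, up to 2^{(τ-s)j}. The
  -- geometric sum of all increments of U is then at most B.
  hBκ : 2 * ((2 * (v * γ)⁻¹ * τ ^ τ * Real.exp 1 * 2 ^ τ) * κ) ≤ B * (1 - 2 ^ (τ - s))
  -- The number 16/R comes from the gap (R/16)2^{-j} between consecutive strips; the variations of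
  -- all increments of η add up to at most v/2.
  hκR : 16 * κ / R ≤ v / 2 * (1 - 2 ^ (1 - s))
  -- One summand for each of the four terms of the next error, with the common factor 2^{-sj}
  -- removed; the right side carries the gain 2^{-s} of one step.
  hsmall : B * κ + κ * ((2 * (v * γ)⁻¹ * τ ^ τ * Real.exp 1 * 2 ^ τ) * κ) + B * κ +
    2 * (Real.exp 1 * ε) ≤ κ * 2 ^ (-s)

/-- The inductive bounds of the iteration. -/
structure ApproxDiag.Good (R v τ s B κ : ℝ) (ω : Fin d → ℝ) (V : ℂ → ℂ)
    (M : ℂ → Lattice d → ℂ) (j : ℕ) (S : ApproxDiag d) : Prop where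
  hU : KerBound (width R j) ((1 / 2) ^ j) (S.U - kone) (B * (1 - (2 ^ (τ - s)) ^ j))
  hη : HoloPer (width R j) S.η
  lip : ∀ z ∈ strip (width R j), ∀ a : ℝ,
    ‖S.η z - S.η (z - a)‖ ≤ v / 2 * (1 - (2 ^ (1 - s)) ^ j) * torusNorm a
  hE : KerBound (width R j) ((1 / 2) ^ j) S.E (κ * (2 ^ (-s)) ^ j)
  -- Estimates hold on the whole strip, but the equation involves values of V and is required only
  -- along orbits free of poles.
  eqn : ∀ z ∈ strip (width R j), (∀ n, ¬ IsPole V (z - dotFreq n ω)) → ∀ n,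
    V z * S.U z n + kmul ω (truncKer M j) S.U z n =
      S.U z n * (V (z - dotFreq n ω) + S.η (z - dotFreq n ω)) + S.E z n

variable {R v γ τ s B κ ε : ℝ} {ω : Fin d → ℝ} {V : ℂ → ℂ} {M : ℂ → Lattice d → ℂ}
  {g : Lattice d → ℂ → ℂ}

/-- The solution of the linearized equation. -/
def solveKer (ω : Fin d → ℝ) (g : Lattice d → ℂ → ℂ) (S : ApproxDiag d) : ℂ → Lattice d → ℂ :=
  fun z n => S.E z n * -perturbedInverse ω g S.η n z

/-- One step of the iteration. -/
def ApproxDiag.next (ω : Fin d → ℝ) (g : Lattice d → ℂ → ℂ) (M : ℂ → Lattice d → ℂ) (j : ℕ)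
    (S : ApproxDiag d) : ApproxDiag d where
  U := S.U + kmul ω S.U (solveKer ω g S)
  η := fun z => S.η z + S.E z 0
  -- Inserting U + UW produces E - UE, which leaves -(U - 1)E. The next two terms are EW and the
  -- product of UW with the new diagonal shift, and the last is the contribution of the new shell of
  -- M.
  E := -kmul ω (S.U - kone) S.E + kmul ω S.E (solveKer ω g S) +
    -(fun z n => kmul ω S.U (solveKer ω g S) z n * S.E (z - dotFreq n ω) 0) +
    kmul ω (truncKer M (j + 1) - truncKer M j) (S.U + kmul ω S.U (solveKer ω g S))

lemma ApproxDiag.Good.zero (hκ : 0 ≤ κ) :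
    ApproxDiag.Good R v τ s B κ ω V M 0 ⟨kone, fun _ => 0, 0⟩ := by
  refine ⟨?_, holoPer_zero _, fun z hz a => by simp, ?_, fun z hz hp n => ?_⟩
  · simpa using KerBound.zero (width R 0) 1
  · exact (KerBound.zero _ _).weaken (by simpa using hκ)
  · by_cases hn : n = 0
    · simp [truncKer_zero, kmul, kone, hn]
    · simp [truncKer_zero, kmul, kone, hn]

variable {j : ℕ} {S : ApproxDiag d}

lemma ratio_nonneg (x : ℝ) : (0 : ℝ) ≤ 2 ^ x := (Real.rpow_pos_of_pos two_pos x).le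

lemma ratio_le_one {x : ℝ} (hx : x ≤ 0) : (2 : ℝ) ^ x ≤ 1 :=
  Real.rpow_le_one_of_one_le_of_nonpos (by norm_num) hx

lemma ApproxDiag.Good.lip_half (hv : 0 < v) (hS : S.Good R v τ s B κ ω V M j) :
    ∀ z ∈ strip (width R j), ∀ a : ℝ, ‖S.η z - S.η (z - a)‖ ≤ v / 2 * torusNorm a := by
  intro z hz a
  refine (hS.lip z hz a).trans (mul_le_mul_of_nonneg_right ?_ (torusNorm_nonneg a))
  have := pow_nonneg (ratio_nonneg (1 - s)) j
  nlinarith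

lemma ApproxDiag.Good.kerBound_U (hD : IterationData R v γ τ s B κ ε ω V M g)
    (hS : S.Good R v τ s B κ ω V M j) : KerBound (width R j) ((1 / 2) ^ j) S.U 2 := by
  have h0 : (2 ^ (τ - s) : ℝ) ^ j ≤ 1 :=
    pow_le_one₀ (ratio_nonneg _) (ratio_le_one (by linarith [hD.hs]))
  have h1 := pow_nonneg (ratio_nonneg (τ - s)) j
  have h := hS.hU.add (KerBound.kone (d := d) (r := width R j) (ρ := (1 / 2) ^ j))
    (mul_nonneg hD.hB (by linarith)) zero_le_one
  rw [sub_add_cancel] at h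
  exact h.weaken (by nlinarith [hD.hB, hD.hB1])

/-- Halving the rate leaves room for e^{2^{-(j+1)}|n|}, which absorbs the divisor ⟨n⟩^τ at the price
2^{τ(j+1)}. Together with the size 2^{-sj} of the error this gives 2^{(τ-s)j}. -/
lemma ApproxDiag.Good.kerBound_solveKer (hD : IterationData R v γ τ s B κ ε ω V M g)
    (hS : S.Good R v τ s B κ ω V M j) :
    KerBound (width R j) ((1 / 2) ^ (j + 1)) (solveKer ω g S)
      ((2 * (v * γ)⁻¹ * τ ^ τ * Real.exp 1 * 2 ^ τ) * κ * (2 ^ (τ - s)) ^ j) := by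
  have hR := hD.hR
  have hv := hD.hv
  have hγ := hD.hγ
  have hτ : 0 < τ := by linarith [hD.hτ]
  have hr : width R j ≤ R := (width_le hR j).trans (by linarith)
  have hl := hS.lip_half hv
  have h := hS.hE.mul_multiplier (ρ' := (1 / 2) ^ (j + 1))
    (m := fun n z => -perturbedInverse ω g S.η n z)
    (b := 2 * (v * γ)⁻¹ * τ ^ τ * Real.exp 1 * (2 ^ τ) ^ (j + 1))
    (fun n => ?_) (by positivity) (fun n z hz => ?_)
  · refine h.weaken (le_of_eq ?_)
    have : ((2 : ℝ) ^ (τ - s)) = 2 ^ τ * 2 ^ (-s) := by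
      rw [← Real.rpow_add two_pos, sub_eq_add_neg]
    rw [this, mul_pow, pow_succ]
    ring
  · have h1 := holoPer_perturbedInverse hD.hg hv hγ hD.hω hr hS.hη hl n
    exact ⟨h1.diff.neg, fun z hz => by rw [h1.per z hz]⟩
  · rw [norm_neg]
    refine (norm_perturbedInverse_le hD.hg hv hγ hD.hω hr hl n hz).trans ?_
    have h2 := bracket_rpow_le (n := n) hτ (ρ := (1 / 2) ^ (j + 1)) (by positivity)
      (pow_le_one₀ (by norm_num) (by norm_num))
    have h3 : (((1 / 2 : ℝ) ^ (j + 1)) ^ τ)⁻¹ = (2 ^ τ) ^ (j + 1) := by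
      rw [← Real.rpow_natCast, ← Real.rpow_mul (by norm_num), ← Real.rpow_natCast (2 ^ τ),
        ← Real.rpow_mul (by norm_num), mul_comm τ, ← Real.inv_rpow (by norm_num)]
      norm_num
    have h4 : (1 / 2 : ℝ) ^ j - (1 / 2) ^ (j + 1) = (1 / 2) ^ (j + 1) := by ring
    rw [h3] at h2
    rw [h4]
    calc _ ≤ 2 * (v * γ)⁻¹ * (τ ^ τ * Real.exp 1 * (2 ^ τ) ^ (j + 1) *
          Real.exp ((1 / 2) ^ (j + 1) * ‖n‖)) := by gcongr
      _ = _ := by ring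

lemma ApproxDiag.Good.kerBound_increment (hD : IterationData R v γ τ s B κ ε ω V M g)
    (hS : S.Good R v τ s B κ ω V M j) :
    KerBound (width R j) ((1 / 2) ^ (j + 1)) (kmul ω S.U (solveKer ω g S))
      (B * (1 - 2 ^ (τ - s)) * (2 ^ (τ - s)) ^ j) := by
  have hU := (hS.kerBound_U hD).mono (r' := width R j) (ρ' := (1 / 2) ^ (j + 1)) le_rfl
    (pow_le_pow_of_le_one (by norm_num) (by norm_num) (by omega)) le_rfl
  refine (hU.kmul (hS.kerBound_solveKer hD) (by positivity) zero_le_two).weaken ?_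
  have := pow_nonneg (ratio_nonneg (τ - s)) j
  have := mul_le_mul_of_nonneg_right hD.hBκ this
  linarith

lemma ApproxDiag.Good.eqn_next (hD : IterationData R v γ τ s B κ ε ω V M g)
    (hS : S.Good R v τ s B κ ω V M j) {z : ℂ} (hz : z ∈ strip (width R j))
    (hp : ∀ n, ¬ IsPole V (z - dotFreq n ω)) (n : Lattice d) :
    V z * (S.next ω g M j).U z n + kmul ω (truncKer M (j + 1)) (S.next ω g M j).U z n =
      (S.next ω g M j).U z n * (V (z - dotFreq n ω) + (S.next ω g M j).η (z - dotFreq n ω)) +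
        (S.next ω g M j).E z n := by
  set ρ : ℝ := (1 / 2) ^ (j + 1) with hρdef
  have hρ : 0 ≤ ρ := by positivity
  have hρj : ρ ≤ (1 / 2) ^ j := pow_le_pow_of_le_one (by norm_num) (by norm_num) (by omega)
  have hs0 : 0 ≤ s := by linarith [hD.hs, hD.hτ]
  have hr : width R j ≤ R := (width_le hD.hR j).trans (by linarith [hD.hR])
  set W := solveKer ω g S with hW
  set X := kmul ω S.U W with hX
  have bU := (hS.kerBound_U hD).mono (le_refl (width R j)) hρj le_rfl
  have bu := hS.hU.mono (le_refl (width R j)) hρj le_rfl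
  have bE := hS.hE.mono (le_refl (width R j)) hρj le_rfl
  have bW := hS.kerBound_solveKer hD
  have bX := hS.kerBound_increment hD
  have bM : ∀ i, KerBound (width R j) ρ (truncKer M i) _ := fun i =>
    (hD.hM.truncKer i hs0 hρ).mono (width_le hD.hR j) le_rfl le_rfl
  rw [← hW, ← hX] at bX
  rw [← hW] at bW
  have bdM : KerBound (width R j) ρ (truncKer M (j + 1) - truncKer M j) _ :=
    (hD.hM.truncKer_sub j hs0).mono (width_le hD.hR j) le_rfl le_rfl
  have e0 := hS.eqn z hz hp
  -- the linearized equation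
  have hlin : ∀ m k : Lattice d, (V (z - dotFreq m ω) + S.η (z - dotFreq m ω)) *
      W (z - dotFreq m ω) k = W (z - dotFreq m ω) k * (V (z - dotFreq (m + k) ω) +
        S.η (z - dotFreq (m + k) ω)) - (S.E (z - dotFreq m ω) k -
          if k = 0 then S.E (z - dotFreq m ω) 0 else 0) := by
    intro m k
    by_cases hk : k = 0
    · simp [hk, hW, solveKer, perturbedInverse]
    · have h1 := perturbedInverse_mul hD.hg hD.hv hD.hγ hD.hω hr (hS.lip_half hD.hv) hk
        (sub_real_mem_strip hz (dotFreq m ω)) (hp m) (by rw [sub_dotFreq_add]; exact hp _)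
      rw [sub_dotFreq_add] at h1
      simp only [hW, solveKer, hk, if_false, sub_zero]
      linear_combination -S.E (z - dotFreq m ω) k * h1
  -- By associativity this is ((truncated M) U) W, into which the inductive equation is inserted
  -- term by term. The diagonal part of E contributes only through the term l = n.
  have hMX : kmul ω (truncKer M j) X z n = X z n * (V (z - dotFreq n ω) + S.η (z - dotFreq n ω)) -
      kmul ω S.U S.E z n + S.U z n * S.E (z - dotFreq n ω) 0 + kmul ω S.E W z n - V z * X z n := by
    rw [hX, ← (bM j).kmul_assoc bU bW hρ hz n, ← hX]
    refine HasSum.tsum_eq ?_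
    have hsingle : HasSum (fun l : Lattice d => if l = n then S.U z n * S.E (z - dotFreq n ω) 0
        else 0) (S.U z n * S.E (z - dotFreq n ω) 0) := hasSum_ite_eq n _
    have hall := ((((bU.hasSum_kmul (ω := ω) bW hρ hz n).mul_right
      (V (z - dotFreq n ω) + S.η (z - dotFreq n ω))).sub (bU.hasSum_kmul (ω := ω) bE hρ hz n)).add
        hsingle).add (bE.hasSum_kmul (ω := ω) bW hρ hz n) |>.sub
          ((bU.hasSum_kmul (ω := ω) bW hρ hz n).mul_left (V z))
    refine hall.congr_fun fun l => ?_
    have h1 := hlin l (n - l)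
    rw [add_sub_cancel] at h1
    have h2 := e0 l
    have h3 : (if l = n then S.U z n * S.E (z - dotFreq n ω) 0 else 0) =
        S.U z l * (if n - l = 0 then S.E (z - dotFreq l ω) 0 else 0) := by
      by_cases h : l = n
      · simp [h]
      · simp [h, sub_eq_zero, Ne.symm h]
    rw [h3]
    linear_combination S.U z l * h1 + W (z - dotFreq l ω) (n - l) * h2
  have hEU : kmul ω S.U S.E z n = kmul ω (S.U - kone) S.E z n + S.E z n := by
    have := bu.add_kmul (ω := ω) (KerBound.kone) bE hρ hz n
    rw [sub_add_cancel, kone_kmul] at this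
    exact this
  have hsplit : kmul ω (truncKer M (j + 1)) (S.U + X) z n = kmul ω (truncKer M j) S.U z n +
      kmul ω (truncKer M j) X z n +
        kmul ω (truncKer M (j + 1) - truncKer M j) (S.U + X) z n := by
    rw [← (bM j).kmul_add bU bX hρ hz n]
    have := (bM j).add_kmul (ω := ω) bdM (bU.add bX zero_le_two (by
      have := pow_nonneg (ratio_nonneg (τ - s)) j
      have := ratio_le_one (show τ - s ≤ 0 by linarith [hD.hs])
      have := hD.hB
      have : 0 ≤ 1 - (2 : ℝ) ^ (τ - s) := by linarith
      positivity)) hρ hz n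
    rw [← this, add_sub_cancel]
  simp only [ApproxDiag.next, ← hW, ← hX]
  rw [hsplit, hMX, hEU]
  simp only [Pi.add_apply, Pi.neg_apply]
  linear_combination e0 n

/-- The budgets for U and η telescope, as in (1 - p^j) + (1 - p)p^j = 1 - p^{j+1}. Every term of the
new error is a small multiple of 2^{-sj}, and the smallness condition gains the remaining factor
2^{-s}. -/
lemma ApproxDiag.Good.next (hD : IterationData R v γ τ s B κ ε ω V M g)
    (hS : S.Good R v τ s B κ ω V M j) :
    (S.next ω g M j).Good R v τ s B κ ω V M (j + 1) := by
  have hR := hD.hR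
  have hv := hD.hv
  have hB := hD.hB
  have hκ := hD.hκ
  have hε := hD.hε
  have hγ := hD.hγ
  have hwl := (width_succ_lt hR j).le
  have hρ : (0 : ℝ) ≤ (1 / 2) ^ (j + 1) := by positivity
  have hρj : (1 / 2 : ℝ) ^ (j + 1) ≤ (1 / 2) ^ j :=
    pow_le_pow_of_le_one (by norm_num) (by norm_num) (by omega)
  have hs0 : 0 ≤ s := by linarith [hD.hs, hD.hτ]
  have hτ0 : 0 < τ := by linarith [hD.hτ]
  have hp1 : (2 : ℝ) ^ (τ - s) ≤ 1 := ratio_le_one (by linarith [hD.hs])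
  have hp0 := ratio_nonneg (τ - s)
  have hpj0 := pow_nonneg hp0 j
  have hpj1 : ((2 : ℝ) ^ (τ - s)) ^ j ≤ 1 := pow_le_one₀ hp0 hp1
  have ha0 := ratio_nonneg (-s)
  have haj0 := pow_nonneg ha0 j
  have bU := (hS.kerBound_U hD).mono hwl hρj le_rfl
  have bu := hS.hU.mono hwl hρj (C' := B) (by nlinarith)
  have bE := hS.hE.mono hwl hρj le_rfl
  have bW := (hS.kerBound_solveKer hD).mono hwl le_rfl le_rfl
  have bX := (hS.kerBound_increment hD).mono hwl le_rfl le_rfl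
  have bX0 : 0 ≤ B * (1 - 2 ^ (τ - s)) * (2 ^ (τ - s)) ^ j := by
    have : 0 ≤ 1 - (2 : ℝ) ^ (τ - s) := by linarith
    positivity
  have hUadd := bu.add bX hB bX0
  have hunext : KerBound (width R (j + 1)) ((1 / 2) ^ (j + 1)) ((S.next ω g M j).U - kone)
      (B * (1 - (2 ^ (τ - s)) ^ (j + 1))) := by
    have h := (hS.hU.mono hwl hρj le_rfl).add bX (mul_nonneg hB (by linarith)) bX0
    have e : (S.next ω g M j).U - kone = S.U - kone + kmul ω S.U (solveKer ω g S) := by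
      simp only [ApproxDiag.next]; abel
    rw [e]
    refine h.weaken (le_of_eq ?_)
    ring
  have bUn : KerBound (width R (j + 1)) ((1 / 2) ^ (j + 1))
      (S.U + kmul ω S.U (solveKer ω g S)) 2 := by
    have hpj2 := pow_nonneg hp0 (j + 1)
    have h := (hunext.weaken (C' := B) (by nlinarith)).add KerBound.kone hB zero_le_one
    rw [sub_add_cancel] at h
    exact h.weaken (by linarith [hD.hB1])
  have hE0 : ∀ z ∈ strip (width R j), ‖S.E z 0‖ ≤ κ * (2 ^ (-s)) ^ j := fun z hz =>
    hS.hE.norm_le (by positivity) (by positivity) hz 0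
  refine ⟨hunext, ⟨?_, ?_⟩, ?_, ?_, fun z hz hp n =>
    hS.eqn_next hD (strip_mono hwl hz) hp n⟩
  · exact (hS.hη.mono hwl).diff.add (bE.holo 0).diff
  · intro z hz
    simp only [ApproxDiag.next]
    rw [(hS.hη.mono hwl).per z hz, (bE.holo 0).per z hz]
  · intro z hz a
    simp only [ApproxDiag.next]
    have h1 := hS.lip z (strip_mono hwl hz) a
    have h2 := (hS.hE.holo 0).norm_sub_le (width_succ_lt hR j) hE0 hz a
    -- Dividing 2^{-sj} by a gap proportional to 2^{-j} gives the ratio 2^{1-s}.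
    have h3 : κ * (2 ^ (-s)) ^ j / (width R j - width R (j + 1)) ≤
        v / 2 * (1 - 2 ^ (1 - s)) * (2 ^ (1 - s)) ^ j := by
      have e1 : ((2 : ℝ) ^ (1 - s)) = 2 * 2 ^ (-s) := by
        rw [sub_eq_add_neg, Real.rpow_add two_pos, Real.rpow_one]
      have e2 : κ * (2 ^ (-s)) ^ j / (width R j - width R (j + 1)) =
          16 * κ / R * (2 ^ (1 - s)) ^ j := by
        rw [width_sub, e1, mul_pow, one_div, inv_pow]
        field_simp
      rw [e2]
      exact mul_le_mul_of_nonneg_right hD.hκR (pow_nonneg (ratio_nonneg _) _)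
    calc ‖S.η z + S.E z 0 - (S.η (z - a) + S.E (z - a) 0)‖
        ≤ ‖S.η z - S.η (z - a)‖ + ‖S.E z 0 - S.E (z - a) 0‖ := by
          rw [add_sub_add_comm]; exact norm_add_le _ _
      _ ≤ v / 2 * (1 - (2 ^ (1 - s)) ^ j) * torusNorm a +
          v / 2 * (1 - 2 ^ (1 - s)) * (2 ^ (1 - s)) ^ j * torusNorm a :=
          add_le_add h1 (h2.trans (mul_le_mul_of_nonneg_right h3 (torusNorm_nonneg a)))
      _ = _ := by ring
  · have k1 := (bu.kmul (ω := ω) bE hρ hB).neg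
    have k2 := bE.kmul (ω := ω) bW hρ (by positivity)
    have k3 := (bX.mul_multiplier (ρ' := (1 / 2) ^ (j + 1))
      (m := fun n z => S.E (z - dotFreq n ω) 0) (b := κ * (2 ^ (-s)) ^ j) (fun n =>
        ⟨(bE.holo 0).diff.comp (differentiableOn_id.sub_const _)
          fun z hz => sub_real_mem_strip hz _, fun z hz => by
            rw [add_sub_right_comm, (bE.holo 0).per _ (sub_real_mem_strip hz _)]⟩)
      (by positivity) (fun n z hz => by
        simpa using hE0 _ (sub_real_mem_strip (strip_mono hwl hz) _))).neg
    have k4 := ((hD.hM.truncKer_sub j hs0).mono (hwl.trans (width_le hR j)) le_rfl le_rfl).kmul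
      (ω := ω) bUn hρ (by positivity)
    have k12 := k1.add k2 (by positivity) (by positivity)
    have k123 := k12.add k3 (by positivity) (by positivity)
    have k := k123.add k4 (by positivity) (by positivity)
    refine KerBound.weaken k ?_
    have hsm := mul_le_mul_of_nonneg_right hD.hsmall haj0
    have i2 : κ * (2 ^ (-s)) ^ j * (2 * (v * γ)⁻¹ * τ ^ τ * Real.exp 1 * 2 ^ τ * κ *
        (2 ^ (τ - s)) ^ j) ≤ κ * (2 ^ (-s)) ^ j *
          (2 * (v * γ)⁻¹ * τ ^ τ * Real.exp 1 * 2 ^ τ * κ * 1) := by gcongr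
    have i3 : κ * (2 ^ (-s)) ^ j * (B * (1 - 2 ^ (τ - s)) * (2 ^ (τ - s)) ^ j) ≤
        κ * (2 ^ (-s)) ^ j * (B * 1 * 1) := by
      gcongr
      linarith
    rw [pow_succ]
    linarith

end Step

/-! ### Convergence of the iteration and power-law decay -/

section Limit

variable {d : ℕ} {R v γ τ s B κ ε : ℝ} {ω : Fin d → ℝ} {V : ℂ → ℂ} {M : ℂ → Lattice d → ℂ}
  {g : Lattice d → ℂ → ℂ}

lemma PolyBound.kerBound {r : ℝ} (hM : PolyBound r s M ε) (hs : 0 ≤ s) : KerBound r 0 M ε := by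
  refine ⟨hM.holo, le_trans (ENNReal.tsum_le_tsum fun n => ?_) hM.bound⟩
  rw [expWeight]
  gcongr
  rw [zero_mul, Real.exp_zero]
  exact Real.one_le_rpow (one_le_bracket n) hs

/-- The sequence of approximate diagonalizations. -/
def approxSeq (ω : Fin d → ℝ) (g : Lattice d → ℂ → ℂ) (M : ℂ → Lattice d → ℂ) :
    ℕ → ApproxDiag d
  | 0 => ⟨kone, fun _ => 0, 0⟩
  | j + 1 => (approxSeq ω g M j).next ω g M j

/-- The increment of the conjugating kernel at step `j`. -/
def increment (ω : Fin d → ℝ) (g : Lattice d → ℂ → ℂ) (M : ℂ → Lattice d → ℂ) (j : ℕ) :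
    ℂ → Lattice d → ℂ :=
  kmul ω (approxSeq ω g M j).U (solveKer ω g (approxSeq ω g M j))

/-- The conjugating kernel. -/
def limitKer (ω : Fin d → ℝ) (g : Lattice d → ℂ → ℂ) (M : ℂ → Lattice d → ℂ) :
    ℂ → Lattice d → ℂ :=
  fun z n => kone z n + ∑' j, increment ω g M j z n

/-- The correction of the potential. -/
def limitShift (ω : Fin d → ℝ) (g : Lattice d → ℂ → ℂ) (M : ℂ → Lattice d → ℂ) : ℂ → ℂ :=
  fun z => ∑' j, (approxSeq ω g M j).E z 0

lemma approxSeq_good (hD : IterationData R v γ τ s B κ ε ω V M g) (j : ℕ) :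
    (approxSeq ω g M j).Good R v τ s B κ ω V M j := by
  induction j with
  | zero => exact ApproxDiag.Good.zero hD.hκ
  | succ j ih => exact ih.next hD

lemma approxSeq_U (j : ℕ) (z : ℂ) (n : Lattice d) :
    (approxSeq ω g M j).U z n = kone z n + ∑ i ∈ Finset.range j, increment ω g M i z n := by
  induction j with
  | zero => simp [approxSeq]
  | succ j ih =>
    rw [Finset.sum_range_succ, ← add_assoc, ← ih]
    rfl

lemma approxSeq_η (j : ℕ) (z : ℂ) :
    (approxSeq ω g M j).η z = ∑ i ∈ Finset.range j, (approxSeq ω g M i).E z 0 := by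
  induction j with
  | zero => simp [approxSeq]
  | succ j ih =>
    rw [Finset.sum_range_succ, ← ih]
    rfl

lemma IterationData.ratio_lt_one (hD : IterationData R v γ τ s B κ ε ω V M g) :
    (2 : ℝ) ^ (τ - s) < 1 :=
  Real.rpow_lt_one_of_one_lt_of_neg (by norm_num) (by linarith [hD.hs])

lemma increment_bound (hD : IterationData R v γ τ s B κ ε ω V M g) (j : ℕ) :
    KerBound (R / 2 + R / 8) ((1 / 2) ^ (j + 1)) (increment ω g M j)
      (B * (1 - 2 ^ (τ - s)) * (2 ^ (τ - s)) ^ j) :=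
  ((approxSeq_good hD j).kerBound_increment hD).mono (le_width hD.hR j) le_rfl le_rfl

lemma hasSum_increment_bound (hD : IterationData R v γ τ s B κ ε ω V M g) :
    HasSum (fun j : ℕ => B * (1 - 2 ^ (τ - s)) * ((2 : ℝ) ^ (τ - s)) ^ j) B := by
  have h1 := hD.ratio_lt_one
  have h := (hasSum_geometric_of_lt_one (ratio_nonneg (τ - s)) h1).mul_left
    (B * (1 - 2 ^ (τ - s)))
  rwa [mul_assoc, mul_inv_cancel₀ (by linarith), mul_one] at h

lemma increment_bound_nonneg (hD : IterationData R v γ τ s B κ ε ω V M g) (j : ℕ) :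
    0 ≤ B * (1 - 2 ^ (τ - s)) * ((2 : ℝ) ^ (τ - s)) ^ j := by
  have h1 := hD.ratio_lt_one
  have := hD.hB
  have := ratio_nonneg (τ - s)
  have : 0 ≤ 1 - (2 : ℝ) ^ (τ - s) := by linarith
  positivity

lemma summable_increment (hD : IterationData R v γ τ s B κ ε ω V M g) {z : ℂ}
    (hz : z ∈ strip (R / 2 + R / 8)) (n : Lattice d) :
    Summable fun j => increment ω g M j z n :=
  Summable.of_norm_bounded (hasSum_increment_bound hD).summable fun j =>
    (increment_bound hD j).norm_le (by positivity) (increment_bound_nonneg hD j) hz n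

lemma tendsto_approxSeq_U (hD : IterationData R v γ τ s B κ ε ω V M g) {z : ℂ}
    (hz : z ∈ strip (R / 2 + R / 8)) (n : Lattice d) :
    Tendsto (fun j => (approxSeq ω g M j).U z n) atTop (𝓝 (limitKer ω g M z n)) := by
  simp only [approxSeq_U]
  exact (summable_increment hD hz n).hasSum.tendsto_sum_nat.const_add _

lemma norm_approxSeq_E_le (hD : IterationData R v γ τ s B κ ε ω V M g) {z : ℂ}
    (hz : z ∈ strip (R / 2 + R / 8)) (n : Lattice d) (j : ℕ) :
    ‖(approxSeq ω g M j).E z n‖ ≤ κ * (2 ^ (-s)) ^ j :=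
  (approxSeq_good hD j).hE.norm_le (by positivity)
    (mul_nonneg hD.hκ (pow_nonneg (ratio_nonneg _) _)) (strip_mono (le_width hD.hR j) hz) n

lemma IterationData.summable_error (hD : IterationData R v γ τ s B κ ε ω V M g) :
    Summable fun j : ℕ => κ * ((2 : ℝ) ^ (-s)) ^ j :=
  (summable_geometric_of_lt_one (ratio_nonneg _) (Real.rpow_lt_one_of_one_lt_of_neg (by norm_num)
    (by linarith [hD.hs, hD.hτ]))).mul_left κ

lemma tendsto_approxSeq_η (hD : IterationData R v γ τ s B κ ε ω V M g) {z : ℂ}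
    (hz : z ∈ strip (R / 2 + R / 8)) :
    Tendsto (fun j => (approxSeq ω g M j).η z) atTop (𝓝 (limitShift ω g M z)) := by
  simp only [approxSeq_η]
  exact (Summable.of_norm_bounded hD.summable_error fun j =>
    norm_approxSeq_E_le hD hz 0 j).hasSum.tendsto_sum_nat

lemma norm_limitShift_sub_le (hD : IterationData R v γ τ s B κ ε ω V M g) {z : ℂ}
    (hz : z ∈ strip (R / 2 + R / 8)) (a : ℝ) :
    ‖limitShift ω g M z - limitShift ω g M (z - a)‖ ≤ v / 2 * torusNorm a :=
  le_of_tendsto ((tendsto_approxSeq_η hD hz).sub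
    (tendsto_approxSeq_η hD (sub_real_mem_strip hz a))).norm
    (Eventually.of_forall fun j => (approxSeq_good hD j).lip_half hD.hv z
      (strip_mono (le_width hD.hR j) hz) a)

lemma limit_eqn (hD : IterationData R v γ τ s B κ ε ω V M g) {z : ℂ}
    (hz : z ∈ strip (R / 2 + R / 8)) (hp : ∀ n, ¬ IsPole V (z - dotFreq n ω)) (n : Lattice d) :
    V z * limitKer ω g M z n + kmul ω M (limitKer ω g M) z n =
      limitKer ω g M z n * (V (z - dotFreq n ω) + limitShift ω g M (z - dotFreq n ω)) := by
  have hs0 : 0 ≤ s := by linarith [hD.hs, hD.hτ]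
  have hzM : z ∈ strip (3 * R / 4) := strip_mono (by linarith [hD.hR]) hz
  have hMs := (hD.hM.kerBound hs0).summable_norm le_rfl hzM
  have hconv : Tendsto (fun j => kmul ω (truncKer M j) (approxSeq ω g M j).U z n) atTop
      (𝓝 (kmul ω M (limitKer ω g M) z n)) := by
    -- The majorant is 2|M(z, l)|: truncation only removes entries, and every U of the sequence is
    -- bounded by 2.
    refine tendsto_tsum_of_dominated_convergence (hMs.mul_right 2) (fun l => ?_)
      (Eventually.of_forall fun j l => ?_)
    · refine Tendsto.mul ?_ (tendsto_approxSeq_U hD (sub_real_mem_strip hz _) _)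
      refine tendsto_const_nhds.congr' ?_
      filter_upwards [(tendsto_pow_atTop_atTop_of_one_lt (one_lt_two (α := ℝ))).eventually_gt_atTop
        (bracket l)] with j hj
      simp [truncKer, hj]
    · rw [norm_mul]
      have h1 : ‖truncKer M j z l‖ ≤ ‖M z l‖ := by
        unfold truncKer
        split_ifs <;> simp
      have h2 := ((approxSeq_good hD j).kerBound_U hD).norm_le (by positivity) zero_le_two
        (strip_mono (le_width hD.hR j) (sub_real_mem_strip hz (dotFreq l ω))) (n - l)
      gcongr
  have hE : Tendsto (fun j => (approxSeq ω g M j).E z n) atTop (𝓝 0) :=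
    squeeze_zero_norm (norm_approxSeq_E_le hD hz n) hD.summable_error.tendsto_atTop_zero
  have hL := ((tendsto_approxSeq_U hD hz n).const_mul (V z)).add hconv
  have hR := ((tendsto_approxSeq_U hD hz n).mul
    ((tendsto_approxSeq_η hD (sub_real_mem_strip hz (dotFreq n ω))).const_add
      (V (z - dotFreq n ω)))).add hE
  rw [add_zero] at hR
  exact tendsto_nhds_unique (hL.congr fun j => (approxSeq_good hD j).eqn z
    (strip_mono (le_width hD.hR j) hz) hp n) hR

/-- A majorant of the conjugating kernel minus the identity. -/
def kerMajorant (R : ℝ) (ω : Fin d → ℝ) (g : Lattice d → ℂ → ℂ) (M : ℂ → Lattice d → ℂ)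
    (n : Lattice d) : ℝ≥0∞ :=
  ∑' j, supE (R / 2 + R / 8) fun z => increment ω g M j z n

lemma tsum_kerMajorant_le (hD : IterationData R v γ τ s B κ ε ω V M g) :
    ∑' n, kerMajorant R ω g M n ≤ ENNReal.ofReal B := by
  unfold kerMajorant
  rw [ENNReal.tsum_comm, ← (hasSum_increment_bound hD).tsum_eq,
    ENNReal.ofReal_tsum_of_nonneg (increment_bound_nonneg hD) (hasSum_increment_bound hD).summable]
  exact ENNReal.tsum_le_tsum fun j => (tsum_supE_le (by positivity)).trans
    (increment_bound hD j).bound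

lemma enorm_limitKer_sub_le {z : ℂ} (hz : z ∈ strip (R / 2 + R / 8)) (n : Lattice d) :
    ‖limitKer ω g M z n - kone z n‖ₑ ≤ kerMajorant R ω g M n := by
  rw [limitKer, add_sub_cancel_left]
  exact enorm_tsum_le_tsum_enorm.trans (ENNReal.tsum_le_tsum fun j =>
    enorm_le_supE hz fun z => increment ω g M j z n)

/-- Exponential decay at rate 2^{-(j+1)} is at most a constant times 2^{t(j+1)}⟨n⟩^{-t}. Against the
size 2^{(τ-s)j} of the increments this sums geometrically exactly when t < s - τ. -/
lemma kerMajorant_le (hD : IterationData R v γ τ s B κ ε ω V M g) {t : ℝ} (ht : 0 < t)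
    (hts : t < s - τ) (n : Lattice d) :
    kerMajorant R ω g M n ≤ ENNReal.ofReal
      (B * (t ^ t * Real.exp 1 * 2 ^ t * (1 - 2 ^ (τ - s + t))⁻¹) * bracket n ^ (-t)) := by
  have hq : (2 : ℝ) ^ (τ - s + t) < 1 :=
    Real.rpow_lt_one_of_one_lt_of_neg (by norm_num) (by linarith)
  have hB := hD.hB
  have hb := bracket_pos n
  have hgeo := (hasSum_geometric_of_lt_one (ratio_nonneg (τ - s + t)) hq).mul_left
    (B * (t ^ t * Real.exp 1 * 2 ^ t) * bracket n ^ (-t))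
  have hsum : B * (t ^ t * Real.exp 1 * 2 ^ t * (1 - 2 ^ (τ - s + t))⁻¹) * bracket n ^ (-t) =
      ∑' j : ℕ, B * (t ^ t * Real.exp 1 * 2 ^ t) * bracket n ^ (-t) *
        ((2 : ℝ) ^ (τ - s + t)) ^ j := by
    rw [hgeo.tsum_eq]; ring
  rw [hsum, ENNReal.ofReal_tsum_of_nonneg (fun j => ?_) hgeo.summable]
  · refine ENNReal.tsum_le_tsum fun j => supE_le fun z hz => ?_
    rw [← ofReal_norm]
    apply ENNReal.ofReal_le_ofReal
    refine ((increment_bound hD j).norm_le_exp (increment_bound_nonneg hD j) hz n).trans ?_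
    have h2 := bracket_rpow_le (n := n) ht (ρ := (1 / 2) ^ (j + 1)) (by positivity)
      (pow_le_one₀ (by norm_num) (by norm_num))
    have h3 : (((1 / 2 : ℝ) ^ (j + 1)) ^ t)⁻¹ = (2 ^ t) ^ (j + 1) := by
      rw [← Real.rpow_natCast, ← Real.rpow_mul (by norm_num), ← Real.rpow_natCast (2 ^ t),
        ← Real.rpow_mul (by norm_num), mul_comm t, ← Real.inv_rpow (by norm_num)]
      norm_num
    rw [h3] at h2
    have h4 : Real.exp (-((1 / 2) ^ (j + 1) * ‖n‖)) ≤
        t ^ t * Real.exp 1 * (2 ^ t) ^ (j + 1) * bracket n ^ (-t) := by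
      rw [Real.exp_neg, Real.rpow_neg hb.le, ← div_eq_mul_inv, le_div_iff₀ (by positivity),
        inv_mul_le_iff₀ (Real.exp_pos _)]
      linarith
    have h5 : B * (1 - 2 ^ (τ - s)) * ((2 : ℝ) ^ (τ - s)) ^ j ≤ B * ((2 : ℝ) ^ (τ - s)) ^ j := by
      have := ratio_nonneg (τ - s)
      have h6 := mul_nonneg hB (pow_nonneg this j)
      nlinarith
    calc _ ≤ B * ((2 : ℝ) ^ (τ - s)) ^ j *
          (t ^ t * Real.exp 1 * (2 ^ t) ^ (j + 1) * bracket n ^ (-t)) := by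
          have := ratio_nonneg (τ - s)
          gcongr
      _ = _ := by
          rw [Real.rpow_add two_pos, mul_pow]
          ring
  · have := ratio_nonneg (τ - s + t)
    positivity

end Limit

/-! ### Choice of the constants -/

section Diagonalization

variable {d : ℕ}

/-- A diagonalization `(V + M) U = U (V + η)` by a kernel `U` close to the identity. -/
structure Diagonalization (r v t : ℝ) (ω : Fin d → ℝ) (V : ℂ → ℂ) (M : ℂ → Lattice d → ℂ)
    (U : ℂ → Lattice d → ℂ) (η : ℂ → ℂ) (m b : Lattice d → ℝ) : Prop where
  summable_m : Summable m
  norm_M_le : ∀ z ∈ strip r, ∀ n, ‖M z n‖ ≤ m n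
  summable_b : Summable b
  tsum_b_le : ∑' n, b n ≤ 1 / 4
  b_le : ∀ n, b n ≤ 1 / 4 * bracket n ^ (-t)
  norm_U_sub_le : ∀ z ∈ strip r, ∀ n, ‖U z n - kone z n‖ ≤ b n
  lip : ∀ z ∈ strip r, ∀ a : ℝ, ‖η z - η (z - a)‖ ≤ v / 2 * torusNorm a
  eqn : ∀ z ∈ strip r, (∀ n, ¬ IsPole V (z - dotFreq n ω)) → ∀ n,
    V z * U z n + kmul ω M U z n = U z n * (V (z - dotFreq n ω) + η (z - dotFreq n ω))

lemma IterationData.diagonalization {R v γ τ s B κ ε t : ℝ} {ω : Fin d → ℝ} {V : ℂ → ℂ}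
    {M : ℂ → Lattice d → ℂ} {g : Lattice d → ℂ → ℂ} (hD : IterationData R v γ τ s B κ ε ω V M g)
    (ht : 0 < t) (hts : t < s - τ) (hB : B ≤ 1 / 4)
    (hBt : B * (t ^ t * Real.exp 1 * 2 ^ t * (1 - 2 ^ (τ - s + t))⁻¹) ≤ 1 / 4) :
    Diagonalization (R / 2 + R / 8) v t ω V M (limitKer ω g M) (limitShift ω g M)
      (fun n => (supE (3 * R / 4) fun z => M z n).toReal)
      (fun n => (kerMajorant R ω g M n).toReal) := by
  have hs0 : 0 ≤ s := by linarith [hD.hs, hD.hτ]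
  have hMk := hD.hM.kerBound hs0
  have hMt := (tsum_supE_le le_rfl).trans hMk.bound
  have hUt := tsum_kerMajorant_le hD
  have hUtop : ∑' n, kerMajorant R ω g M n ≠ ⊤ := ne_top_of_le_ne_top ENNReal.ofReal_ne_top hUt
  refine ⟨ENNReal.summable_toReal (ne_top_of_le_ne_top ENNReal.ofReal_ne_top hMt),
    fun z hz n => ?_, ENNReal.summable_toReal hUtop, ?_, fun n => ?_, fun z hz n => ?_,
    fun z hz a => norm_limitShift_sub_le hD hz a, fun z hz hp n => limit_eqn hD hz hp n⟩
  · rw [← toReal_enorm]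
    refine ENNReal.toReal_mono (ne_top_of_le_ne_top ENNReal.ofReal_ne_top
      ((ENNReal.le_tsum n).trans hMt)) ?_
    exact enorm_le_supE (strip_mono (by linarith [hD.hR]) hz) fun z => M z n
  · rw [← ENNReal.tsum_toReal_eq (ENNReal.ne_top_of_tsum_ne_top hUtop)]
    exact (ENNReal.toReal_le_of_le_ofReal hD.hB hUt).trans hB
  · have hb := bracket_pos n
    refine (ENNReal.toReal_le_of_le_ofReal ?_ (kerMajorant_le hD ht hts n)).trans ?_
    · have hq : (2 : ℝ) ^ (τ - s + t) < 1 :=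
        Real.rpow_lt_one_of_one_lt_of_neg (by norm_num) (by linarith)
      have : 0 < 1 - (2 : ℝ) ^ (τ - s + t) := by linarith
      have := hD.hB
      positivity
    · gcongr
  · rw [← toReal_enorm]
    exact ENNReal.toReal_mono (ENNReal.ne_top_of_tsum_ne_top hUtop n) (enorm_limitKer_sub_le hz n)

lemma exists_divisorInverse {R v γ τ : ℝ} {ω : Fin d → ℝ} {V : ℂ → ℂ} (hv : 0 < v) (hγ : 0 < γ)
    (hω : ω ∈ DC d τ γ) (hV : PotentialClass R V) (hm : MonotoneConst R V v) :
    ∃ g, DivisorInverse R v ω V g := by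
  have h : ∀ n : Lattice d, ∃ g : ℂ → ℂ, n ≠ 0 → HoloPer R g ∧
      (∀ z ∈ strip R, ‖g z‖ ≤ (v * torusNorm (dotFreq n ω))⁻¹) ∧
      ∀ z ∈ strip R, ¬ IsPole V z → ¬ IsPole V (z - dotFreq n ω) →
        g z * (V z - V (z - dotFreq n ω)) = 1 := by
    intro n
    by_cases hn : n = 0
    · exact ⟨0, fun h => absurd hn h⟩
    · obtain ⟨g, hg⟩ := hV.exists_inv_difference hv hm (torusNorm_dotFreq_pos hγ hω hn)
      exact ⟨g, fun _ => hg⟩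
  choose g hg using h
  exact ⟨g, fun n hn => (hg n hn).1, fun n hn => (hg n hn).2.1, fun n hn => (hg n hn).2.2⟩

/-- Kernels of small norm are diagonalized by kernels close to the identity. -/
theorem exists_diagonalization {R γ τ v s t : ℝ} (hR : 0 < R) (hγ : 0 < γ) (hτ : 1 ≤ τ)
    (hv : 0 < v) (hτs : τ < s) (ht : 0 < t) (hts : t < s - τ) :
    ∃ ε₀ : ℝ, 0 < ε₀ ∧ ∀ ω ∈ DC d τ γ, ∀ V : ℂ → ℂ, PotentialClass R V → MonotoneConst R V v →
      ∀ M : ℂ → Lattice d → ℂ, KernelSpace R s M → kernelNorm R s M < ε₀ →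
        ∃ U η m b, Diagonalization (R / 2 + R / 8) v t ω V M U η m b := by
  obtain ⟨C, hC, hCM⟩ := exists_tsum_supE_le hR
  have hτ0 : 0 < τ := by linarith
  have ha : (0 : ℝ) < 2 ^ (-s) := by positivity
  have ha1 : (2 : ℝ) ^ (-s) ≤ 1 := ratio_le_one (by linarith)
  have hp : 0 < 1 - (2 : ℝ) ^ (τ - s) := by
    have := Real.rpow_lt_one_of_one_lt_of_neg (x := 2) (z := τ - s) (by norm_num) (by linarith)
    linarith
  have hq : 0 < 1 - (2 : ℝ) ^ (1 - s) := by
    have := Real.rpow_lt_one_of_one_lt_of_neg (x := 2) (z := 1 - s) (by norm_num) (by linarith)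
    linarith
  have hq' : 0 < 1 - (2 : ℝ) ^ (τ - s + t) := by
    have := Real.rpow_lt_one_of_one_lt_of_neg (x := 2) (z := τ - s + t) (by norm_num)
      (by linarith)
    linarith
  set Q : ℝ := t ^ t * Real.exp 1 * 2 ^ t * (1 - 2 ^ (τ - s + t))⁻¹ with hQ
  have hQ0 : 0 < Q := by positivity
  set K : ℝ := 2 * (v * γ)⁻¹ * τ ^ τ * Real.exp 1 * 2 ^ τ with hK
  have hK0 : 0 < K := by positivity
  -- The first entry keeps the two terms Bκ of the new error at κ2^{-s}/8 each; the second brings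
  -- the decay constant of U - 1 down to 1/4.
  set B : ℝ := min (2 ^ (-s) / 8) (1 / (4 * Q)) with hBdef
  have hB0 : 0 < B := by positivity
  have hB1 : B ≤ 2 ^ (-s) / 8 := min_le_left _ _
  have hB2 : B * Q ≤ 1 / 4 := by
    calc B * Q ≤ 1 / (4 * Q) * Q := by gcongr; exact min_le_right _ _
      _ = 1 / 4 := by field_simp
  -- The three entries serve, in order, the increments of U, the variation of η, and the error term
  -- quadratic in κ.
  set κ : ℝ := min (B * (1 - 2 ^ (τ - s)) / (2 * K))
    (min (v * R * (1 - 2 ^ (1 - s)) / 32) (2 ^ (-s) / (4 * K))) with hκdef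
  have hκ0 : 0 < κ := by positivity
  have hκ1 : 2 * (K * κ) ≤ B * (1 - 2 ^ (τ - s)) := by
    have : κ ≤ B * (1 - 2 ^ (τ - s)) / (2 * K) := min_le_left _ _
    rw [le_div_iff₀ (by positivity)] at this
    linarith
  have hκ2 : 16 * κ / R ≤ v / 2 * (1 - 2 ^ (1 - s)) := by
    have : κ ≤ v * R * (1 - 2 ^ (1 - s)) / 32 := (min_le_right _ _).trans (min_le_left _ _)
    rw [div_le_iff₀ hR]
    linarith
  have hκ3 : K * κ ≤ 2 ^ (-s) / 4 := by
    have : κ ≤ 2 ^ (-s) / (4 * K) := (min_le_right _ _).trans (min_le_right _ _)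
    rw [le_div_iff₀ (by positivity)] at this
    linarith
  -- Chosen so that the shell term 2eε equals κ2^{-s}/4.
  set ε : ℝ := κ * 2 ^ (-s) / (8 * Real.exp 1) with hεdef
  have hε0 : 0 < ε := by positivity
  refine ⟨ε / C, by positivity, fun ω hω V hV hm M hM hMn => ?_⟩
  obtain ⟨g, hg⟩ := exists_divisorInverse hv hγ hω hV hm
  have hD : IterationData R v γ τ s B κ ε ω V M g := by
    refine ⟨hR, hv, hγ, hτ, hτs, hB0.le, by linarith, hκ0.le, hε0.le, hω, hg,
      ⟨fun n => ?_, ?_⟩, hκ1, hκ2, ?_⟩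
    · exact HoloPer.mono ⟨(hM.holo n).holomorphic, (hM.holo n).periodic⟩ (by linarith)
    · refine (hCM d s M hM).trans (ENNReal.ofReal_le_ofReal ?_)
      rw [lt_div_iff₀ hC] at hMn
      linarith
    · have e1 : 2 * (Real.exp 1 * ε) = κ * 2 ^ (-s) / 4 := by
        rw [hεdef]; field_simp; norm_num
      rw [e1]
      have i1 : B * κ ≤ 2 ^ (-s) / 8 * κ := by gcongr
      have i2 : κ * (K * κ) ≤ κ * (2 ^ (-s) / 4) := by gcongr
      have := mul_pos hκ0 ha
      linarith
  exact ⟨_, _, _, _, hD.diagonalization ht hts (by linarith) hB2⟩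

end Diagonalization

/-! ### Bounded operators on ℓ² and their matrices -/

section RowOperators

variable {d : ℕ}

lemma two_toReal_pos : 0 < (2 : ℝ≥0∞).toReal := by norm_num

lemma exists_weightedShift (a : Lattice d → ℂ) (k : Lattice d) {C : ℝ} (hC : 0 ≤ C)
    (ha : ∀ n, ‖a n‖ ≤ C) :
    ∃ T : Hilb d →L[ℂ] Hilb d, (∀ ψ n, T ψ n = a n * ψ (n + k)) ∧ ‖T‖ ≤ C := by
  have key : ∀ ψ : Hilb d, (∀ n, ‖a n * ψ (n + k)‖ ^ (2 : ℝ≥0∞).toReal ≤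
      C ^ (2 : ℝ≥0∞).toReal * ‖ψ (n + k)‖ ^ (2 : ℝ≥0∞).toReal) := by
    intro ψ n
    rw [norm_mul, Real.mul_rpow (norm_nonneg _) (norm_nonneg _)]
    gcongr
    exact ha n
  have hs : ∀ ψ : Hilb d, Summable fun n => C ^ (2 : ℝ≥0∞).toReal *
      ‖ψ (n + k)‖ ^ (2 : ℝ≥0∞).toReal := fun ψ =>
    (((Equiv.addRight k).summable_iff (f := fun n => ‖ψ n‖ ^ (2 : ℝ≥0∞).toReal)).mpr
      ((lp.memℓp ψ).summable two_toReal_pos)).mul_left _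
  have hmem : ∀ ψ : Hilb d, Memℓp (fun n => a n * ψ (n + k)) 2 := fun ψ =>
    memℓp_gen (Summable.of_nonneg_of_le (fun n => by positivity) (key ψ) (hs ψ))
  let T₀ : Hilb d →ₗ[ℂ] Hilb d :=
    { toFun := fun ψ => ⟨fun n => a n * ψ (n + k), hmem ψ⟩
      map_add' := fun ψ χ => by ext n; exact mul_add _ _ _
      map_smul' := fun c ψ => by ext n; exact mul_left_comm _ _ _ }
  refine ⟨T₀.mkContinuous C fun ψ => ?_, fun ψ n => rfl, LinearMap.mkContinuous_norm_le _ hC _⟩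
  refine lp.norm_le_of_tsum_le two_toReal_pos (by positivity) ?_
  rw [Real.mul_rpow hC (norm_nonneg _), lp.norm_rpow_eq_tsum two_toReal_pos ψ]
  refine (Summable.tsum_le_tsum (key ψ)
    (Summable.of_nonneg_of_le (fun n => by positivity) (key ψ) (hs ψ)) (hs ψ)).trans_eq ?_
  rw [tsum_mul_left]
  congr 1
  exact (Equiv.addRight k).tsum_eq fun n => ‖ψ n‖ ^ (2 : ℝ≥0∞).toReal

/-- Matrices whose diagonals are bounded by a summable sequence act on `ℓ²`. -/
lemma exists_rowOperator (a : Lattice d → Lattice d → ℂ) {c : Lattice d → ℝ} (hc : Summable c)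
    (ha : ∀ n k, ‖a n k‖ ≤ c k) :
    ∃ T : Hilb d →L[ℂ] Hilb d, ‖T‖ ≤ ∑' k, c k ∧
      ∀ ψ n, HasSum (fun l => a n (l - n) * ψ l) (T ψ n) := by
  have hc0 : ∀ k, 0 ≤ c k := fun k => (norm_nonneg _).trans (ha 0 k)
  choose T hT hTn using fun k => exists_weightedShift (fun n => a n k) k (hc0 k) fun n => ha n k
  have hsum : Summable T := Summable.of_norm_bounded hc hTn
  refine ⟨∑' k, T k, tsum_of_norm_bounded hc.hasSum hTn, fun ψ n => ?_⟩
  have h1 := (hsum.hasSum.mapL (ContinuousLinearMap.apply ℂ (Hilb d) ψ)).mapL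
    (lp.evalCLM ℂ (fun _ : Lattice d => ℂ) 2 n)
  have h2 : HasSum (fun k => a n k * ψ (n + k)) ((∑' k, T k) ψ n) := by
    refine h1.congr_fun fun k => ?_
    exact (hT k ψ n).symm
  rw [← (Equiv.subRight n).hasSum_iff] at h2
  refine h2.congr_fun fun l => ?_
  simp

/-- The canonical basis of `ℓ²`. -/
abbrev basisVec (n : Lattice d) : Hilb d := lp.single 2 n (1 : ℂ)

lemma hasSum_basisVec (ψ : Hilb d) : HasSum (fun n => ψ n • basisVec n) ψ := by
  refine (lp.hasSum_single (p := 2) (by norm_num) ψ).congr_fun fun n => ?_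
  rw [basisVec, ← lp.single_smul, smul_eq_mul, mul_one]

lemma hasSum_apply_basisVec (T : Hilb d →L[ℂ] Hilb d) (ψ : Hilb d) (i : Lattice d) :
    HasSum (fun n => ψ n * T (basisVec n) i) (T ψ i) := by
  refine (((hasSum_basisVec ψ).mapL T).mapL
    (lp.evalCLM ℂ (fun _ : Lattice d => ℂ) 2 i)).congr_fun fun n => ?_
  simp only [map_smul, smul_eq_mul]
  rfl

lemma apply_basisVec_of_hasSum {T : Hilb d →L[ℂ] Hilb d} {a : Lattice d → Lattice d → ℂ}
    (hT : ∀ ψ n, HasSum (fun l => a n (l - n) * ψ l) (T ψ n)) (l i : Lattice d) :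
    T (basisVec l) i = a i (l - i) := by
  refine (hT (basisVec l) i).unique ?_
  have : ∀ m, a i (m - i) * (basisVec l : Hilb d) m = if m = l then a i (l - i) else 0 := by
    intro m
    rw [basisVec, lp.single_apply]
    by_cases h : m = l
    · subst h; simp
    · simp [h]
  simp only [this]
  exact hasSum_ite_eq l _

lemma closure_span_basisVec :
    (Submodule.span ℂ (Set.range (basisVec (d := d)))).topologicalClosure = ⊤ := by
  refine eq_top_iff.mpr fun ψ _ => ?_
  refine mem_closure_of_tendsto (hasSum_basisVec ψ) (Eventually.of_forall fun s => ?_)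
  exact Submodule.sum_mem _ fun n _ => Submodule.smul_mem _ _
    (Submodule.subset_span (Set.mem_range_self n))

/-- Every x equals T(Sx), and expanding Sx in the canonical basis writes x as a convergent series of
multiples of the vectors φ. A right inverse suffices. -/
lemma closure_span_image {T S : Hilb d →L[ℂ] Hilb d} (hTS : ∀ x, T (S x) = x)
    {φ : Lattice d → Hilb d} (hφ : ∀ n, ∃ c : ℂ, T (basisVec n) = c • φ n) :
    (Submodule.span ℂ (Set.range φ)).topologicalClosure = ⊤ := by
  refine eq_top_iff.mpr fun x _ => ?_
  rw [← hTS x]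
  refine mem_closure_of_tendsto ((hasSum_basisVec (S x)).mapL T)
    (Eventually.of_forall fun s => ?_)
  refine Submodule.sum_mem _ fun n _ => ?_
  obtain ⟨c, hc⟩ := hφ n
  rw [map_smul, hc]
  exact Submodule.smul_mem _ _ (Submodule.smul_mem _ _
    (Submodule.subset_span (Set.mem_range_self n)))

end RowOperators

/-! ### Diagonal operators plus bounded ones -/

section Perturbation

variable {d : ℕ}

/-- `H` is the sum of the bounded operator `T` and the diagonal operator `D` on its maximal
domain. -/
structure IsDiagPlus (H : Hilb d →ₗ.[ℂ] Hilb d) (T : Hilb d →L[ℂ] Hilb d) (D : Lattice d → ℂ) :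
    Prop where
  mem_domain : ∀ ψ : Hilb d, ψ ∈ H.domain ↔ Memℓp (fun n => D n * ψ n) 2
  apply : ∀ (x : H.domain) (n : Lattice d), H x n = T (x : Hilb d) n + D n * (x : Hilb d) n

variable {H : Hilb d →ₗ.[ℂ] Hilb d} {T A S : Hilb d →L[ℂ] Hilb d} {D Λ : Lattice d → ℂ}

/-- The hopping series converges for every ψ and defines a bounded operator, so the natural domain
of H is that of the potential alone. -/
lemma isDiagPlus_hamiltonian {ω : Fin d → ℝ} {M : ℂ → Lattice d → ℂ} {V : ℂ → ℂ} {z : ℂ}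
    (hT : ∀ ψ n, HasSum (fun l => M (z - dotFreq n ω) (l - n) * ψ l) (T ψ n)) :
    IsDiagPlus (hamiltonian ω M V z) T fun n => V (z - dotFreq n ω) := by
  refine ⟨fun ψ => ⟨fun h => h.2, fun h => ⟨⟨fun n => (hT ψ n).summable, ?_⟩, h⟩⟩, fun x n => ?_⟩
  · have : (fun n => ∑' l, M (z - dotFreq n ω) (l - n) * ψ l) = T ψ := by
      funext n; exact (hT ψ n).tsum_eq
    rw [this]
    exact lp.memℓp _
  · exact congrArg₂ (· + ·) (hT x n).tsum_eq rfl

/-- A solution of the eigenvalue equation or of the resolvent equation lies in the domain. -/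
lemma IsDiagPlus.exists_mem (hH : IsDiagPlus H T D) {ψ χ : Hilb d}
    (h : ∀ n, D n * ψ n + T ψ n = χ n) : ∃ hψ : ψ ∈ H.domain, H ⟨ψ, hψ⟩ = χ := by
  have hmem : ψ ∈ H.domain := by
    rw [hH.mem_domain]
    have : (fun n => D n * ψ n) = (χ - T ψ : Hilb d) := by
      funext n
      rw [lp.coeFn_sub, Pi.sub_apply, ← h n, add_sub_cancel_right]
    rw [this]
    exact lp.memℓp _
  refine ⟨hmem, lp.ext (funext fun n => ?_)⟩
  rw [hH.apply, add_comm]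
  exact h n

lemma IsDiagPlus.basisVec_mem (hH : IsDiagPlus H T D) (n : Lattice d) :
    basisVec n ∈ H.domain := by
  rw [hH.mem_domain]
  have : (fun i => D i * (basisVec n : Hilb d) i) = (D n • basisVec n : Hilb d) := by
    funext i
    change D i * (basisVec n : Hilb d) i = D n * (basisVec n : Hilb d) i
    rw [lp.single_apply]
    by_cases h : i = n
    · subst h; rfl
    · simp [h]
  rw [this]
  exact lp.memℓp _

lemma IsDiagPlus.apply_basisVec (hH : IsDiagPlus H T D) (n : Lattice d) :
    H ⟨basisVec n, hH.basisVec_mem n⟩ = T (basisVec n) + D n • basisVec n := by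
  refine lp.ext (funext fun i => ?_)
  rw [hH.apply, lp.coeFn_add, Pi.add_apply, lp.coeFn_smul, Pi.smul_apply, smul_eq_mul]
  congr 1
  change D i * (basisVec n : Hilb d) i = D n * (basisVec n : Hilb d) i
  rw [lp.single_apply]
  by_cases h : i = n
  · subst h; rfl
  · simp [h]

lemma IsDiagPlus.dense_domain (hH : IsDiagPlus H T D) : Dense (H.domain : Set (Hilb d)) := by
  have h1 : Submodule.span ℂ (Set.range (basisVec (d := d))) ≤ H.domain := by
    rw [Submodule.span_le]
    rintro _ ⟨n, rfl⟩
    exact hH.basisVec_mem n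
  have h2 := Submodule.topologicalClosure_mono h1
  rw [closure_span_basisVec, top_le_iff] at h2
  exact (Submodule.dense_iff_topologicalClosure_eq_top).mpr h2

lemma IsDiagPlus.isFormalAdjoint (hH : IsDiagPlus H T D)
    (hT : ∀ ψ χ : Hilb d, inner ℂ (T ψ) χ = inner ℂ ψ (T χ)) (hD : ∀ n, star (D n) = D n) :
    H.IsFormalAdjoint H := by
  intro x y
  have e : ∀ x : H.domain, ∃ w : Hilb d, H x = T (x : Hilb d) + w ∧
      ∀ n, w n = D n * (x : Hilb d) n := fun x =>
    ⟨⟨_, (hH.mem_domain x).mp x.2⟩, lp.ext (funext fun n => hH.apply x n), fun n => rfl⟩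
  obtain ⟨u, hu, hu'⟩ := e x
  obtain ⟨w, hw, hw'⟩ := e y
  rw [hu, hw, inner_add_left, inner_add_right, hT]
  congr 1
  rw [lp.inner_eq_tsum, lp.inner_eq_tsum]
  refine tsum_congr fun n => ?_
  rw [hu', hw']
  simp only [RCLike.inner_apply, map_mul]
  rw [show (starRingEnd ℂ) (D n) = D n from hD n]
  ring

/-- Symmetry places H inside its adjoint. Testing a vector of the adjoint's domain against the
canonical basis shows that the adjoint acts by the same coordinate formula, and square summability
then puts the vector in the domain of H. -/
lemma IsDiagPlus.isSelfAdjoint (hH : IsDiagPlus H T D)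
    (hT : ∀ ψ χ : Hilb d, inner ℂ (T ψ) χ = inner ℂ ψ (T χ)) (hD : ∀ n, star (D n) = D n) :
    IsSelfAdjoint H := by
  rw [LinearPMap.isSelfAdjoint_def]
  have hdense := hH.dense_domain
  have hle := (hH.isFormalAdjoint hT hD).le_adjoint hdense
  refine (LinearPMap.eq_of_le_of_domain_eq hle (le_antisymm hle.1 fun y hy => ?_)).symm
  refine (hH.exists_mem (ψ := y) (χ := H.adjoint ⟨y, hy⟩) fun n => ?_).1
  have h1 := LinearPMap.adjoint_isFormalAdjoint hdense ⟨y, hy⟩ ⟨basisVec n, hH.basisVec_mem n⟩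
  rw [hH.apply_basisVec, inner_add_right, inner_smul_right, ← hT, lp.inner_single_right,
    lp.inner_single_right, lp.inner_single_right] at h1
  have h2 := congrArg star h1
  simp only [RCLike.inner_apply, one_mul, star_add, star_mul', hD] at h2
  simpa [add_comm] using h2.symm

lemma IsDiagPlus.injective (hH : IsDiagPlus H T D)
    (hT : ∀ ψ χ : Hilb d, inner ℂ (T ψ) χ = inner ℂ ψ (T χ)) (hD : ∀ n, star (D n) = D n)
    {μ : ℂ} (hμ : μ.im ≠ 0) {x : H.domain} (hx : H x = μ • (x : Hilb d)) : (x : Hilb d) = 0 := by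
  have h := hH.isFormalAdjoint hT hD x x
  rw [hx, inner_smul_left, inner_smul_right] at h
  have h1 : ((starRingEnd ℂ) μ - μ) * inner ℂ (x : Hilb d) x = 0 := by
    rw [sub_mul, h, sub_self]
  rcases mul_eq_zero.mp h1 with h2 | h2
  · exfalso
    apply hμ
    have := congrArg Complex.im h2
    simp at this
    linarith
  · exact inner_self_eq_zero.mp h2

/-- `A` intertwines `H` with the diagonal operator `Λ`. -/
def Intertwines (T A : Hilb d →L[ℂ] Hilb d) (D Λ : Lattice d → ℂ) : Prop :=
  ∀ l i, D i * A (basisVec l) i + T (A (basisVec l)) i = Λ l * A (basisVec l) i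

lemma IsDiagPlus.exists_eigen (hH : IsDiagPlus H T D) (hA : Intertwines T A D Λ) (l : Lattice d) :
    ∃ h : A (basisVec l) ∈ H.domain, H ⟨A (basisVec l), h⟩ = Λ l • A (basisVec l) :=
  hH.exists_mem fun n => hA l n

/-- The candidate is A(Λ - μ)⁻¹S. The intertwining relation is checked coordinate by coordinate on
the expansion in the canonical basis, which avoids any question of closedness of H. -/
lemma IsDiagPlus.exists_rightInverse (hH : IsDiagPlus H T D) (hA : Intertwines T A D Λ)
    (hAS : ∀ x, A (S x) = x) {μ : ℂ} {c : ℝ} (hc : 0 < c) (hμ : ∀ n, c ≤ ‖Λ n - μ‖) :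
    ∃ Q : Hilb d →L[ℂ] Hilb d, ∀ y, ∃ h : Q y ∈ H.domain, H ⟨Q y, h⟩ - μ • Q y = y := by
  obtain ⟨G, hG, -⟩ := exists_weightedShift (fun n => (Λ n - μ)⁻¹) (0 : Lattice d)
    (inv_nonneg.mpr hc.le) fun n => by
      rw [norm_inv]
      exact inv_anti₀ hc (hμ n)
  refine ⟨A ∘L G ∘L S, fun y => ?_⟩
  simp only [ContinuousLinearMap.coe_comp, Function.comp_apply]
  set b := G (S y) with hb
  have hbΛ : ∀ n, (S y + μ • b) n = Λ n * b n := by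
    intro n
    have h0 : Λ n - μ ≠ 0 := norm_pos_iff.mp (hc.trans_le (hμ n))
    rw [lp.coeFn_add, Pi.add_apply, lp.coeFn_smul, Pi.smul_apply, smul_eq_mul, hb, hG, add_zero]
    field_simp
    ring
  have heq : ∀ i, D i * A b i + T (A b) i = (y + μ • A b) i := by
    intro i
    have h1 := ((hasSum_apply_basisVec A b i).mul_left (D i)).add
      (hasSum_apply_basisVec (T ∘L A) b i)
    have h2 := hasSum_apply_basisVec A (S y + μ • b) i
    rw [map_add, map_smul, hAS] at h2
    refine h1.unique (h2.congr_fun fun n => ?_)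
    rw [hbΛ]
    simp only [ContinuousLinearMap.coe_comp, Function.comp_apply]
    linear_combination b n * hA n i
  obtain ⟨h, hval⟩ := hH.exists_mem heq
  exact ⟨h, by rw [hval, add_sub_cancel_right]⟩

/-- The eigenvalues are real, hence at distance at least |Im μ| from μ, which gives a right inverse.
Injectivity of H - μ, from symmetry, makes it two-sided. -/
lemma IsDiagPlus.mem_resolventSet (hH : IsDiagPlus H T D) (hA : Intertwines T A D Λ)
    (hAS : ∀ x, A (S x) = x)
    (hT : ∀ ψ χ : Hilb d, inner ℂ (T ψ) χ = inner ℂ ψ (T χ)) (hD : ∀ n, star (D n) = D n)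
    (hΛ : ∀ n, (Λ n).im = 0) {μ : ℂ} (hμ : μ.im ≠ 0) : μ ∈ unboundedResolventSet H := by
  obtain ⟨Q, hQ⟩ := hH.exists_rightInverse hA hAS (μ := μ) (abs_pos.mpr hμ) fun n => by
    have := Complex.abs_im_le_norm (Λ n - μ)
    rwa [Complex.sub_im, hΛ n, zero_sub, abs_neg] at this
  refine ⟨Q, hQ, fun x => ?_⟩
  obtain ⟨h, hval⟩ := hQ (H x - μ • (x : Hilb d))
  set w : H.domain := ⟨Q (H x - μ • (x : Hilb d)), h⟩ - x with hw
  have h0 : (w : Hilb d) = 0 := by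
    refine hH.injective hT hD hμ ?_
    rw [hw, LinearPMap.map_sub, Submodule.coe_sub, smul_sub]
    rw [sub_eq_sub_iff_sub_eq_sub, hval]
  rw [hw, Submodule.coe_sub, sub_eq_zero] at h0
  exact h0

lemma IsDiagPlus.im_eigenvalue (hH : IsDiagPlus H T D) (hA : Intertwines T A D Λ)
    (hT : ∀ ψ χ : Hilb d, inner ℂ (T ψ) χ = inner ℂ ψ (T χ)) (hD : ∀ n, star (D n) = D n)
    {n : Lattice d} (hn : A (basisVec n) ≠ 0) : (Λ n).im = 0 := by
  by_contra h
  obtain ⟨hm, hval⟩ := hH.exists_eigen hA n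
  exact hn (hH.injective hT hD h (x := ⟨_, hm⟩) hval)

/-- The resolvent set stays away from the eigenvalues. -/
lemma IsDiagPlus.exists_le_norm_sub (hH : IsDiagPlus H T D) (hA : Intertwines T A D Λ)
    (hne : ∀ n, A (basisVec n) ≠ 0) {μ : ℂ} (hμ : μ ∈ unboundedResolventSet H) :
    ∃ c : ℝ, 0 < c ∧ ∀ n, c ≤ ‖Λ n - μ‖ := by
  obtain ⟨Q, -, hQ⟩ := hμ
  -- The resolvent divides each eigenvector by Λ - μ, so |Λ - μ|‖Q‖ ≥ 1; adding 1 keeps the constant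
  -- well defined without discussing Q = 0.
  refine ⟨(‖Q‖ + 1)⁻¹, by positivity, fun n => ?_⟩
  obtain ⟨hm, hval⟩ := hH.exists_eigen hA n
  have h1 : (Λ n - μ) • Q (A (basisVec n)) = A (basisVec n) := by
    have := hQ ⟨_, hm⟩
    rwa [hval, ← sub_smul, map_smul] at this
  have h2 : ‖A (basisVec n)‖ ≤ ‖Λ n - μ‖ * (‖Q‖ * ‖A (basisVec n)‖) := by
    conv_lhs => rw [← h1]
    rw [norm_smul]
    gcongr
    exact Q.le_opNorm _
  have h3 : 0 < ‖A (basisVec n)‖ := norm_pos_iff.mpr (hne n)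
  rw [inv_le_iff_one_le_mul₀ (by positivity)]
  have h4 : 1 * ‖A (basisVec n)‖ ≤ (‖Λ n - μ‖ * ‖Q‖) * ‖A (basisVec n)‖ := by linarith
  have h5 := le_of_mul_le_mul_right h4 h3
  nlinarith [norm_nonneg (Λ n - μ)]

end Perturbation

/-! ### From the kernel equation to eigenfunctions -/

section Operators

variable {d : ℕ} {r v t : ℝ} {ω : Fin d → ℝ} {V : ℂ → ℂ} {M U : ℂ → Lattice d → ℂ} {η : ℂ → ℂ}
  {m b : Lattice d → ℝ}

lemma exists_rightInverse_id_add {E : Type*} [NormedAddCommGroup E] [NormedSpace ℂ E]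
    [CompleteSpace E] (P : E →L[ℂ] E) (hP : ‖P‖ < 1) :
    ∃ S : E →L[ℂ] E, ∀ x, S x + P (S x) = x := by
  obtain ⟨u, hu⟩ : IsUnit (1 - -P) := isUnit_one_sub_of_norm_lt_one (by rwa [norm_neg])
  refine ⟨↑u⁻¹, fun x => ?_⟩
  have h : (u : E →L[ℂ] E) * ↑u⁻¹ = 1 := u.mul_inv
  rw [hu, sub_neg_eq_add] at h
  exact congrArg (fun T : E →L[ℂ] E => T x) h

/-- The operators on `ℓ²` attached to a diagonalization. -/
lemma Diagonalization.exists_operators (h : Diagonalization r v t ω V M U η m b) {z : ℂ}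
    (hz : z ∈ strip r) (hp : ∀ n, ¬ IsPole V (z - dotFreq n ω)) :
    ∃ T A S : Hilb d →L[ℂ] Hilb d,
      (∀ ψ n, HasSum (fun l => M (z - dotFreq n ω) (l - n) * ψ l) (T ψ n)) ∧
      (∀ l i, A (basisVec l) i = U (z - dotFreq i ω) (l - i)) ∧ (∀ x, A (S x) = x) ∧
      (∀ l, 3 / 4 ≤ ‖A (basisVec l)‖) ∧
      Intertwines T A (fun n => V (z - dotFreq n ω))
        fun n => V (z - dotFreq n ω) + η (z - dotFreq n ω) := by
  have hzn : ∀ n, z - dotFreq n ω ∈ strip r := fun n => sub_real_mem_strip hz _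
  obtain ⟨T, -, hT⟩ := exists_rowOperator (fun n k => M (z - dotFreq n ω) k) h.summable_m
    fun n k => h.norm_M_le _ (hzn n) k
  obtain ⟨P, hPn, hP⟩ := exists_rowOperator
    (fun n k => U (z - dotFreq n ω) k - kone (z - dotFreq n ω) k) h.summable_b
    fun n k => h.norm_U_sub_le _ (hzn n) k
  have hP1 : ‖P‖ ≤ 1 / 4 := hPn.trans h.tsum_b_le
  obtain ⟨S, hS⟩ := exists_rightInverse_id_add P (by linarith)
  obtain ⟨A, hA⟩ : ∃ A : Hilb d →L[ℂ] Hilb d, ∀ x, A x = x + P x :=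
    ⟨ContinuousLinearMap.id ℂ (Hilb d) + P, fun x => rfl⟩
  have hcol : ∀ l i, A (basisVec l) i = U (z - dotFreq i ω) (l - i) := by
    intro l i
    have h1 := apply_basisVec_of_hasSum
      (a := fun n k => U (z - dotFreq n ω) k - kone (z - dotFreq n ω) k) hP l i
    have h2 : (basisVec l : Hilb d) i = kone (z - dotFreq i ω) (l - i) := by
      rw [lp.single_apply, kone]
      by_cases hil : i = l
      · subst hil; simp
      · simp [hil, sub_eq_zero, Ne.symm hil]
    rw [hA, lp.coeFn_add, Pi.add_apply, h1, h2]
    ring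
  refine ⟨T, A, S, hT, hcol, fun x => ?_, fun l => ?_, fun l i => ?_⟩
  · rw [hA, hS]
  · have h1 : ‖(basisVec l : Hilb d)‖ = 1 := by rw [lp.norm_single (by norm_num), norm_one]
    have h2 : ‖P (basisVec l)‖ ≤ 1 / 4 := by
      refine (P.le_opNorm _).trans ?_
      rw [h1, mul_one]
      exact hP1
    have h3 := norm_sub_le (A (basisVec l)) (P (basisVec l))
    rw [hA, add_sub_cancel_right, h1, ← hA] at h3
    linarith
  · have h1 := h.eqn (z - dotFreq i ω) (hzn i)
      (fun n => by rw [sub_dotFreq_add]; exact hp _) (l - i)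
    rw [sub_dotFreq_sub] at h1
    have h2 : T (A (basisVec l)) i = kmul ω M U (z - dotFreq i ω) (l - i) := by
      rw [← (hT (A (basisVec l)) i).tsum_eq, kmul, ← (Equiv.addRight i).tsum_eq]
      refine tsum_congr fun k => ?_
      simp only [hcol, Equiv.coe_addRight]
      rw [add_sub_cancel_right, sub_dotFreq_add, add_comm k i, sub_sub]
    rw [h2, hcol]
    linear_combination h1

/-- A complete set of eigenfunctions with power-law decay. -/
lemma Diagonalization.exists_eigenfunctions (h : Diagonalization r v t ω V M U η m b)
    {z : ℂ} (hz : z ∈ strip r) (hp : ∀ n, ¬ IsPole V (z - dotFreq n ω)) :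
    ∃ φ : Lattice d → Hilb d,
      (∀ n, IsEigenvector (hamiltonian ω M V z) (φ n) ∧ ‖φ n‖ = 1) ∧
      (Submodule.span ℂ (Set.range φ)).topologicalClosure = ⊤ ∧
      ∀ n i, ‖φ n i‖ ≤ 2 * bracket (n - i) ^ (-t) := by
  obtain ⟨T, A, S, hT, hcol, hAS, hnorm, hint⟩ := h.exists_operators hz hp
  have hH := isDiagPlus_hamiltonian (V := V) hT
  have hpos : ∀ n, 0 < ‖A (basisVec n)‖ := fun n => lt_of_lt_of_le (by norm_num) (hnorm n)
  have hne : ∀ n, ((‖A (basisVec n)‖⁻¹ : ℝ) : ℂ) ≠ 0 := fun n =>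
    Complex.ofReal_ne_zero.mpr (inv_ne_zero (hpos n).ne')
  set φ : Lattice d → Hilb d := fun n => ((‖A (basisVec n)‖⁻¹ : ℝ) : ℂ) • A (basisVec n) with hφ
  have hnormφ : ∀ n, ‖φ n‖ = 1 := by
    intro n
    rw [hφ, norm_smul, Complex.norm_real, norm_inv, norm_norm, inv_mul_cancel₀ (hpos n).ne']
  refine ⟨φ, fun n => ⟨⟨?_, ?_⟩, hnormφ n⟩, ?_, fun n i => ?_⟩
  · rw [← norm_ne_zero_iff, hnormφ]
    exact one_ne_zero
  · refine ⟨V (z - dotFreq n ω) + η (z - dotFreq n ω), ?_⟩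
    refine hH.exists_mem (ψ := φ n) fun i => ?_
    have h1 := hint n i
    simp only [hφ, map_smul, lp.coeFn_smul, Pi.smul_apply, smul_eq_mul]
    linear_combination ((‖A (basisVec n)‖⁻¹ : ℝ) : ℂ) * h1
  · refine closure_span_image hAS fun n => ⟨(‖A (basisVec n)‖ : ℂ), ?_⟩
    rw [hφ, smul_smul, ← Complex.ofReal_mul, mul_inv_cancel₀ (hpos n).ne', Complex.ofReal_one,
      one_smul]
  · rw [hφ, lp.coeFn_smul, Pi.smul_apply, smul_eq_mul, norm_mul, Complex.norm_real, norm_inv,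
      norm_norm, hcol, inv_mul_le_iff₀ (hpos n)]
    have h1 := h.norm_U_sub_le _ (sub_real_mem_strip hz (dotFreq i ω)) (n - i)
    have h2 := h.b_le (n - i)
    have h3 : ‖kone (z - dotFreq i ω) (n - i)‖ ≤ bracket (n - i) ^ (-t) := by
      rw [kone]
      split_ifs with h0
      · rw [h0, bracket_zero, Real.one_rpow, norm_one]
      · rw [norm_zero]
        exact Real.rpow_nonneg (bracket_pos _).le _
    have h4 := norm_sub_norm_le (U (z - dotFreq i ω) (n - i)) (kone (z - dotFreq i ω) (n - i))
    have h5 : 0 ≤ bracket (n - i) ^ (-t) := Real.rpow_nonneg (bracket_pos _).le _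
    -- The entry of U is at most (5/4)⟨n - i⟩^{-t} and the column has norm at least 3/4; the
    -- quotient 5/3 is below 2.
    nlinarith [hnorm n]

/-- At a real phase the involution on kernels is conjugate transposition of matrices. The adjoint
and T then agree on the canonical basis, hence everywhere. -/
lemma symmetric_of_kernelSelfAdjoint {R : ℝ} {z : ℂ} (hz : z ∈ strip R) (hz0 : z.im = 0)
    (hM : KernelSelfAdjoint R ω M) {T : Hilb d →L[ℂ] Hilb d}
    (hT : ∀ ψ n, HasSum (fun l => M (z - dotFreq n ω) (l - n) * ψ l) (T ψ n)) (ψ χ : Hilb d) :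
    inner ℂ (T ψ) χ = inner ℂ ψ (T χ) := by
  have hstar : ∀ n : Lattice d, star (z - dotFreq n ω) = z - dotFreq n ω := fun n =>
    Complex.conj_eq_iff_im.mpr (by simp [hz0])
  have hb : ∀ l, T.adjoint (basisVec l) = T (basisVec l) := by
    intro l
    refine lp.ext (funext fun i => ?_)
    have h1 : inner ℂ (basisVec i) (T.adjoint (basisVec l)) = T.adjoint (basisVec l) i := by
      rw [lp.inner_single_left]; simp
    rw [← h1, ContinuousLinearMap.adjoint_inner_right, lp.inner_single_right]
    rw [apply_basisVec_of_hasSum (a := fun n k => M (z - dotFreq n ω) k) hT,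
      apply_basisVec_of_hasSum (a := fun n k => M (z - dotFreq n ω) k) hT]
    have h2 := hM (z - dotFreq i ω) (sub_real_mem_strip hz _) (l - i)
    rw [kernelStar, hstar, sub_dotFreq_sub, neg_sub] at h2
    simpa using h2
  have hadj : T.adjoint = T := by
    ext ψ i
    refine (hasSum_apply_basisVec T.adjoint ψ i).unique ?_
    simp only [hb]
    exact hasSum_apply_basisVec T ψ i
  rw [← ContinuousLinearMap.adjoint_inner_right, hadj]

end Operators

/-! ### Values of the perturbed potential on the real line -/

section Spectrum

variable {d : ℕ} {R r v γ τ t : ℝ} {ω : Fin d → ℝ} {V : ℂ → ℂ} {η : ℂ → ℂ}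

lemma irrational_freq (hγ : 0 < γ) (hω : ω ∈ DC d τ γ) (i : Fin d) : Irrational (ω i) := by
  rw [irrational_iff_ne_rational]
  intro a q hq h
  have hn : (Pi.single i q : Lattice d) ≠ 0 := by simpa using hq
  have h1 := torusNorm_dotFreq_pos hγ hω hn
  have h2 : dotFreq (Pi.single i q : Lattice d) ω = (a : ℤ) := by
    have hq' : (q : ℝ) ≠ 0 := by exact_mod_cast hq
    rw [dotFreq, Finset.sum_eq_single i (fun j _ hj => by simp [hj]) (by simp)]
    rw [Pi.single_eq_same, h]
    field_simp
  rw [h2, torusNorm_intCast] at h1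
  exact lt_irrefl _ h1

/-- One coordinate suffices: an irrational frequency and 1 generate a dense subgroup of ℝ. -/
lemma dense_orbit (hd : 1 ≤ d) (hγ : 0 < γ) (hω : ω ∈ DC d τ γ) (x : ℝ) :
    Dense {y : ℝ | ∃ (n : Lattice d) (k : ℤ), y = x - dotFreq n ω - k} := by
  have h1 : Dense (AddSubgroup.closure {ω ⟨0, hd⟩, 1} : Set ℝ) :=
    dense_addSubgroupClosure_pair_iff.mpr (by simpa using irrational_freq hγ hω ⟨0, hd⟩)
  have h2 := (Homeomorph.subLeft x).surjective.denseRange.dense_image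
    (Homeomorph.subLeft x).continuous h1
  refine h2.mono ?_
  rintro _ ⟨y, hy, rfl⟩
  obtain ⟨p, q, rfl⟩ := AddSubgroup.mem_closure_pair.mp hy
  refine ⟨Pi.single ⟨0, hd⟩ p, q, ?_⟩
  rw [dotFreq, Finset.sum_eq_single ⟨0, hd⟩ (fun j _ hj => by simp [hj]) (by simp)]
  simp only [Homeomorph.coe_subLeft, Pi.single_eq_same, zsmul_eq_mul, mul_one]
  ring

lemma ofReal_mem_strip (hr : 0 < r) (y : ℝ) : (y : ℂ) ∈ strip r := by
  simpa [strip] using hr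

lemma PotentialClass.countable_real_poles (hV : PotentialClass R V) (hR : 0 < R) :
    {y : ℝ | IsPole V y}.Countable := by
  have h0 : MeromorphicOn V (strip R) := fun z hz => (hV.meromorphic hz).meromorphicAt
  refine (h0.countable_compl_analyticAt_inter.preimage Complex.ofReal_injective).mono ?_
  intro y hy
  exact ⟨fun h => AnalyticAt.not_isPole h hy, ofReal_mem_strip hR y⟩

/-- The difference h(y) - h(y + a) is nonnegative at a maximum of h and nonpositive at a minimum, so
it vanishes somewhere in between. -/
lemma exists_eq_of_periodic {h : ℝ → ℝ} (hc : Continuous h) (hp : Function.Periodic h 1) (a : ℝ) :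
    ∃ y, h y = h (y + a) := by
  obtain ⟨y₁, -, h₁⟩ := isCompact_Icc.exists_isMaxOn (s := Set.Icc (0 : ℝ) 1) ⟨0, by simp⟩
    hc.continuousOn
  obtain ⟨y₂, -, h₂⟩ := isCompact_Icc.exists_isMinOn (s := Set.Icc (0 : ℝ) 1) ⟨0, by simp⟩
    hc.continuousOn
  obtain ⟨u₁, hu₁, e₁⟩ := hp.exists_mem_Ico₀ one_pos (y₁ + a)
  obtain ⟨u₂, hu₂, e₂⟩ := hp.exists_mem_Ico₀ one_pos (y₂ + a)
  have k₁ : h u₁ ≤ h y₁ := h₁ (Set.Ico_subset_Icc_self hu₁)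
  have k₂ : h y₂ ≤ h u₂ := h₂ (Set.Ico_subset_Icc_self hu₂)
  obtain ⟨y, hy⟩ := mem_range_of_exists_le_of_exists_ge (c := 0)
    (f := fun y => h y - h (y + a)) (by fun_prop)
    ⟨y₂, by simp only [e₂]; linarith⟩ ⟨y₁, by simp only [e₁]; linarith⟩
  exact ⟨y, sub_eq_zero.mp hy⟩

lemma eq_sub_int_of_torusLipschitz {L : ℝ}
    (hη : ∀ y a : ℝ, ‖η y - η ((y : ℂ) - a)‖ ≤ L * torusNorm a) (y : ℝ) (k : ℤ) :
    η ((y : ℂ) - k) = η y := by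
  have := hη y k
  rw [torusNorm_intCast, mul_zero] at this
  have := sub_eq_zero.mp (norm_le_zero_iff.mp this)
  rw [this, Complex.ofReal_intCast]

lemma continuous_of_torusLipschitz {L : ℝ} (hL : 0 ≤ L)
    (hη : ∀ y a : ℝ, ‖η y - η ((y : ℂ) - a)‖ ≤ L * torusNorm a) : Continuous fun y : ℝ => η y := by
  refine (LipschitzWith.of_dist_le_mul (K := ⟨L, hL⟩) fun y y' => ?_).continuous
  rw [dist_eq_norm, dist_eq_norm]
  have h1 := hη y (y - y')
  have h2 := torusNorm_le_abs_sub (y - y') 0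
  rw [Int.cast_zero, sub_zero] at h2
  rw [show (y : ℂ) - ((y - y' : ℝ) : ℂ) = y' by push_cast; ring] at h1
  exact h1.trans (mul_le_mul_of_nonneg_left h2 hL)

/-- A continuous perturbation of a monotone potential, real on the real axis, takes values
arbitrarily close to every real number. -/
lemma PotentialClass.not_bounded_away (hV : PotentialClass R V) (hR : 0 < R) (hv : 0 < v)
    (hm : MonotoneConst R V v)
    (hη : ∀ y a : ℝ, ‖η y - η ((y : ℂ) - a)‖ ≤ v / 2 * torusNorm a) {E : ℂ} {c : ℝ} (hc : 0 < c)
    (hF : ∀ y : ℝ, ¬ IsPole V y → (V y + η y - E).im = 0 ∧ c ≤ ‖V y + η y - E‖) : False := by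
  classical
  have hηper : ∀ y : ℝ, η ((y : ℂ) + 1) = η y := fun y => by
    simpa using eq_sub_int_of_torusLipschitz hη y (-1)
  have hηc := continuous_of_torusLipschitz (by positivity) hη
  -- The value 0 at poles makes the reciprocal continuous there, since |V| tends to infinity while η
  -- stays bounded nearby. Elsewhere the lower bound c excludes blow-up.
  set H : ℝ → ℂ := fun y => if IsPole V y then 0 else (V y + η y - E)⁻¹ with hH
  have hpunct : ∀ y : ℝ, Tendsto (fun y : ℝ => (y : ℂ)) (𝓝[≠] y) (𝓝[≠] (y : ℂ)) := fun y =>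
    tendsto_nhdsWithin_iff.mpr ⟨(Complex.continuous_ofReal.tendsto y).mono_left nhdsWithin_le_nhds,
      by filter_upwards [self_mem_nhdsWithin] with w hw h
         exact hw (Complex.ofReal_injective h)⟩
  have hHc : Continuous H := by
    rw [continuous_iff_continuousAt]
    intro y
    have hev := (hpunct y).eventually (hV.eventually_not_isPole (ofReal_mem_strip hR y))
    rw [continuousAt_iff_punctured_nhds]
    have hcongr : ∀ᶠ w : ℝ in 𝓝[≠] y, (V w + η w - E)⁻¹ = H w := by
      filter_upwards [hev] with w hw
      rw [hH]; simp only [hw, if_false]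
    refine Tendsto.congr' hcongr ?_
    by_cases hy : IsPole V y
    · have h1 : Tendsto (fun w : ℝ => ‖V w‖) (𝓝[≠] y) atTop :=
        (tendsto_norm_atTop_iff_cobounded.mpr ((tendsto_cobounded_iff_meromorphicOrderAt_neg
          (hV.meromorphic (ofReal_mem_strip hR y)).meromorphicAt).mpr hy)).comp (hpunct y)
      have h2 : Tendsto (fun w : ℝ => ‖V w + η w - E‖) (𝓝[≠] y) atTop := by
        have h3 : ∀ᶠ w : ℝ in 𝓝[≠] y, ‖η w - E‖ < ‖η y - E‖ + 1 :=
          nhdsWithin_le_nhds (((hηc.sub continuous_const).norm.tendsto y).eventually_lt_const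
            (by simp))
        refine tendsto_atTop_mono' _ ?_
          (tendsto_atTop_add_const_right _ (-(‖η y - E‖ + 1)) h1)
        filter_upwards [h3] with w hw
        have := norm_sub_le (V w + η w - E) (η w - E)
        rw [show V w + η w - E - (η w - E) = V w by ring] at this
        linarith
      have h4 : H y = 0 := by rw [hH]; simp [hy]
      rw [h4]
      exact tendsto_inv₀_cobounded.comp (tendsto_norm_atTop_iff_cobounded.mp h2)
    · have h1 : ContinuousAt (fun w : ℝ => V w) y :=
        ContinuousAt.comp (hV.analyticAt (ofReal_mem_strip hR y) hy).continuousAt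
          Complex.continuous_ofReal.continuousAt
      have h2 : H y = (V y + η y - E)⁻¹ := by rw [hH]; simp [hy]
      rw [h2]
      exact (((h1.add hηc.continuousAt).sub continuousAt_const).inv₀
        (norm_pos_iff.mp (hc.trans_le (hF y hy).2))).tendsto.mono_left nhdsWithin_le_nhds
  have hpole : ∀ y : ℝ, IsPole V ((y : ℂ) + 1) ↔ IsPole V y := by
    intro y
    have e : meromorphicOrderAt V ((y : ℂ) + 1) = meromorphicOrderAt V y := by
      have h1 : V =ᶠ[𝓝 (y : ℂ)] fun z => V (z + 1) := by
        filter_upwards [(isOpen_strip R).mem_nhds (ofReal_mem_strip hR y)] with z hz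
        exact (hV.periodic z hz).symm
      rw [meromorphicOrderAt_congr (h1.filter_mono nhdsWithin_le_nhds)]
      exact (meromorphicOrderAt_fun_comp_add_const_eq_meromorphicOrderAt).symm
    rw [IsPole, IsPole, e]
  have hHper : Function.Periodic H 1 := by
    intro y
    rw [hH]
    simp only
    push_cast
    rw [hηper, hV.periodic _ (ofReal_mem_strip hR y)]
    simp only [hpole]
  have hHim : ∀ y, (H y).im = 0 := by
    intro y
    rw [hH]
    by_cases hy : IsPole V y
    · simp [hy]
    · simp only [hy, if_false, Complex.inv_im, (hF y hy).1, neg_zero, zero_div]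
  -- The shift avoids the countable set of differences of real poles; otherwise both values could be
  -- 0 at poles and their equality would say nothing about V.
  obtain ⟨a, ha, haP⟩ : ∃ a ∈ Set.Ioo (0 : ℝ) 1,
      a ∉ Set.image2 (fun y y' => y' - y) {y : ℝ | IsPole V y} {y : ℝ | IsPole V y} := by
    have hcount := (hV.countable_real_poles hR).image2 (hV.countable_real_poles hR)
      fun y y' => y' - y
    obtain ⟨a, ha1, ha2⟩ := (hcount.dense_compl ℝ).inter_open_nonempty _ isOpen_Ioo
      (Set.nonempty_Ioo.mpr (zero_lt_one (α := ℝ)))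
    exact ⟨a, ha1, ha2⟩
  obtain ⟨y, hy⟩ := exists_eq_of_periodic (Complex.continuous_re.comp hHc)
    (fun y => by simp only [Function.comp_apply, hHper y]) a
  have hyH : H y = H (y + a) := Complex.ext hy (by rw [hHim, hHim])
  rw [hH] at hyH
  simp only at hyH
  by_cases h1 : IsPole V y <;> by_cases h2 : IsPole V ((y + a : ℝ) : ℂ)
  · exact haP ⟨y, h1, y + a, h2, by ring⟩
  · rw [if_pos h1, if_neg h2, eq_comm, inv_eq_zero] at hyH
    have := (hF _ h2).2
    rw [hyH, norm_zero] at this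
    linarith
  · rw [if_pos h2, if_neg h1, inv_eq_zero] at hyH
    have := (hF _ h1).2
    rw [hyH, norm_zero] at this
    linarith
  -- Equal reciprocals mean that V and -η have the same increment over a, which must be at least
  -- v‖a‖ and at most (v/2)‖a‖.
  · rw [if_neg h1, if_neg h2, inv_inj] at hyH
    have h3 : ((y + a : ℝ) : ℂ) - a = y := by push_cast; ring
    have h4 := hm _ (ofReal_mem_strip hR (y + a)) a h2 (by rwa [h3])
    have h5 := hη (y + a) a
    rw [h3] at h4 h5
    have h6 : V ((y + a : ℝ) : ℂ) - V y = -(η ((y + a : ℝ) : ℂ) - η y) := by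
      linear_combination -hyH
    rw [h6, norm_neg] at h4
    have h7 := torusNorm_pos_of_mem_Ioo ha
    have := mul_pos hv h7
    linarith

end Spectrum

/-! ### The spectrum in the self-adjoint case -/

section SelfAdjoint

variable {d : ℕ} {R r v γ τ t : ℝ} {ω : Fin d → ℝ} {V η : ℂ → ℂ} {M U : ℂ → Lattice d → ℂ}
  {m b : Lattice d → ℝ}

/-- Values of a periodic function on a dense orbit control its values at points of continuity. -/
lemma PotentialClass.orbit_control (hV : PotentialClass R V) (hR : 0 < R) {L : ℝ} (hL : 0 ≤ L)
    (hη : ∀ y a : ℝ, ‖η y - η ((y : ℂ) - a)‖ ≤ L * torusNorm a) {x : ℝ}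
    (hdense : Dense {y : ℝ | ∃ (n : Lattice d) (k : ℤ), y = x - dotFreq n ω - k})
    {C : Set ℂ} (hC : IsClosed C)
    (hx : ∀ n, V (x - dotFreq n ω) + η (x - dotFreq n ω) ∈ C) {y : ℝ} (hy : ¬ IsPole V y) :
    V y + η y ∈ C := by
  have hcont : ContinuousAt (fun w : ℝ => V w + η w) y :=
    (ContinuousAt.comp (hV.analyticAt (ofReal_mem_strip hR y) hy).continuousAt
      Complex.continuous_ofReal.continuousAt).add
        (continuous_of_torusLipschitz hL hη).continuousAt
  have h1 := hcont.continuousWithinAt.mem_closure_image (hdense y)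
  refine closure_minimal ?_ hC h1
  rintro _ ⟨w, ⟨n, k, rfl⟩, rfl⟩
  have e : ((x - dotFreq n ω - k : ℝ) : ℂ) = ((x - dotFreq n ω : ℝ) : ℂ) - k := by push_cast; rfl
  have h2 := hx n
  rw [← Complex.ofReal_sub] at h2
  simp only
  rwa [e, eq_sub_int_of_torusLipschitz hη, periodic_int hV.periodic (ofReal_mem_strip hR _)]

/-- The self-adjoint case: the operator is self-adjoint and its spectrum is the real line. -/
lemma Diagonalization.selfAdjoint_and_spectrum (h : Diagonalization r v t ω V M U η m b)
    (hr : 0 < r) (hrR : r ≤ R) (hd : 1 ≤ d) (hv : 0 < v) (hγ : 0 < γ) (hω : ω ∈ DC d τ γ)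
    (hV : PotentialClass R V) (hm : MonotoneConst R V v) (hM : KernelSelfAdjoint R ω M)
    (hVs : PotentialSelfAdjoint R V) {z : ℂ} (hz : z ∈ phaseSet ω V 0) :
    IsSelfAdjoint (hamiltonian ω M V z) ∧
      unboundedSpectrum (hamiltonian ω M V z) = Set.range ((↑) : ℝ → ℂ) := by
  have hR : 0 < R := hr.trans_le hrR
  have hz0 : z.im = 0 := abs_nonpos_iff.mp hz.1
  obtain ⟨x, rfl⟩ : ∃ x : ℝ, (x : ℂ) = z := ⟨z.re, Complex.ext rfl (by simp [hz0])⟩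
  have hzr : (x : ℂ) ∈ strip r := ofReal_mem_strip hr x
  obtain ⟨T, A, S, hT, hcol, hAS, hnorm, hint⟩ := h.exists_operators hzr hz.2
  have hH := isDiagPlus_hamiltonian (V := V) hT
  have hsym := symmetric_of_kernelSelfAdjoint (strip_mono hrR hzr) hz0 hM hT
  have hD : ∀ n : Lattice d, star (V (x - dotFreq n ω)) = V (x - dotFreq n ω) := by
    intro n
    have hs : star ((x : ℂ) - dotFreq n ω) = x - dotFreq n ω :=
      Complex.conj_eq_iff_im.mpr (by simp)
    have := hVs (x - dotFreq n ω) (sub_real_mem_strip (strip_mono hrR hzr) _)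
    rwa [hs] at this
  have hne : ∀ n, A (basisVec n) ≠ 0 := fun n => by
    rw [← norm_pos_iff]
    exact lt_of_lt_of_le (by norm_num) (hnorm n)
  have hΛ := fun n => hH.im_eigenvalue hint hsym hD (hne n)
  refine ⟨hH.isSelfAdjoint hsym hD, Set.Subset.antisymm (fun μ hμ => ?_) ?_⟩
  · have him : μ.im = 0 := by
      by_contra h0
      exact hμ (hH.mem_resolventSet hint hAS hsym hD hΛ h0)
    exact ⟨μ.re, Complex.ext rfl (by simp [him])⟩
  · rintro _ ⟨E, rfl⟩ hE
    obtain ⟨c, hc, hcn⟩ := hH.exists_le_norm_sub hint hne hE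
    have hη : ∀ y a : ℝ, ‖η y - η ((y : ℂ) - a)‖ ≤ v / 2 * torusNorm a := fun y a =>
      h.lip y (ofReal_mem_strip hr y) a
    refine hV.not_bounded_away hR hv hm hη (E := E) hc fun y hy => ?_
    -- Being real and at distance at least c from E is a closed condition satisfied by all
    -- eigenvalues, so density of the orbit extends it to every real point that is not a pole.
    refine hV.orbit_control hR (by positivity) hη (dense_orbit hd hγ hω x)
      (C := {w : ℂ | (w - E).im = 0 ∧ c ≤ ‖w - E‖}) ?_ (fun n => ⟨?_, hcn n⟩) hy
    · have hsub : Continuous fun w : ℂ => w - E := continuous_id.sub continuous_const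
      exact (isClosed_eq (Complex.continuous_im.comp hsub) continuous_const).inter
        (isClosed_le continuous_const hsub.norm)
    · rw [Complex.sub_im, hΛ n, Complex.ofReal_im, sub_zero]

end SelfAdjoint

end PowerLaw

end

open PowerLaw in
theorem theorem1p2 (d : ℕ) (hd : 1 ≤ d) (R α₀ γ τ v δ s : ℝ)
    (hR : 0 < R) (hα₀ : 0 < α₀) (hγ : 0 < γ) (hτ : (d : ℝ) < τ) (hv : 0 < v) (hδ : 0 < δ)
    (hs : α₀ + τ + (d : ℝ) / 2 + 7 * δ < s) :
    ∃ ε₀ : ℝ, 0 < ε₀ ∧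
      ∀ ω ∈ DC d τ γ, ∀ V : ℂ → ℂ, PotentialClass R V → monotoneModulus R V = v →
      ∀ M : ℂ → Lattice d → ℂ, KernelSpace R s M → kernelNorm R s M < ε₀ →
        (∀ z ∈ phaseSet ω V (R / 2), ∃ φ : Lattice d → Hilb d,
          (∀ n, IsEigenvector (hamiltonian ω M V z) (φ n) ∧ ‖φ n‖ = 1) ∧
          (Submodule.span ℂ (Set.range φ)).topologicalClosure = ⊤ ∧
          ∀ n i, ‖φ n i‖ ≤ 2 * bracket (n - i) ^ (-s + τ + 7 * δ)) ∧
        (KernelSelfAdjoint R ω M → PotentialSelfAdjoint R V →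
          ∀ x ∈ phaseSet ω V 0,
            IsSelfAdjoint (hamiltonian ω M V x) ∧
            unboundedSpectrum (hamiltonian ω M V x) = Set.range ((↑) : ℝ → ℂ)) := by
  have hd' : (1 : ℝ) ≤ d := by exact_mod_cast hd
  -- The decay exponent t = s - τ - 7δ is positive by the hypothesis on s and below s - τ because δ
  -- > 0.
  obtain ⟨ε₀, hε₀, h⟩ := exists_diagonalization (d := d) (t := s - τ - 7 * δ) hR hγ
    (by linarith : 1 ≤ τ) hv (by linarith : τ < s) (by linarith) (by linarith)
  refine ⟨ε₀, hε₀, fun ω hω V hV hVv M hM hMn => ?_⟩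
  have hm := monotoneConst_of_monotoneModulus hv hVv
  obtain ⟨U, η, m, b, hdiag⟩ := h ω hω V hV hm M hM hMn
  refine ⟨fun z hz => ?_, fun hMs hVs x hx => ?_⟩
  · have hzs : z ∈ strip (R / 2 + R / 8) := lt_of_le_of_lt hz.1 (by linarith)
    have := hdiag.exists_eigenfunctions hzs hz.2
    rwa [show -(s - τ - 7 * δ) = -s + τ + 7 * δ by ring] at this
  · exact hdiag.selfAdjoint_and_spectrum (by linarith) (by linarith) hd hv hγ hω hV hm hMs hVs hx
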